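/- **Setting.** Consider the linear system $x(k+1)=Ax(k)$ with states $x_1,\dots,x_n$ and $m$ sensors, where sensor $l$ measures exactly one state $x_{s(l)}$. Its system digraph has the states as nodes and a link $x_j\to x_i$ iff $a_{ij}\neq 0$. An SCC is a strongly connected component (a class of mutually reachable states), and a *parent SCC* is an SCC with no link to a state outside of it. The states *equivalent* to $x_i$ are the other states in the SCC of $x_i$. A *matching* is a set of links no two of which share a start node or an end node; its *unmatched* states are those that are not the start node of one of its links. The system is *structurally observable* if there are a matrix $A'$ with the same zero pattern as $A$ and a measurement matrix $H$ whose row $l$ is nonzero exactly at $s(l)$ such that $(A',H)$ is observable. The sensors communicate over a prediction-fusion network $\mathcal G_\beta$, which is strongly connected and has all self-loops, and over a measurement-fusion hub network with $\mathcal N_\alpha(i)=\{i\}\cup\{\text{hub sensors}\}$. Let $D_H=\mathrm{blockdiag}_i\big(\sum_{j\in\mathcal N_\alpha(i)}H_j^\top H_j\big)$, where $H_j$ is the $j$-th row of $H$. *Structural distributed observability* means that $(W\otimes A',D_H)$ is observable for some $A',H$ as above and some row-stochastic $W$ with $w_{ij}\ne0$ iff $\mathcal G_\beta$ has the link $j\to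 i$. Let $\mathcal M$ be a maximum matching of the system digraph such that every unmatched state is measured, suppose that the system is structurally observable, and let the hub sensors ($\alpha$-sensors) be those that measure an unmatched state. Let $k$ be a $\beta$-sensor that is not an $\alpha$-sensor: $x_{s(k)}$ belongs to a parent SCC $C$ and is not unmatched. **Theorem.** 1. For any finite family of sensors, each measuring one state, that measures all unmatched states of $\mathcal M$, the system is structurally observable with these sensors if and only if at least one state of every parent SCC is measured. 2. If sensor $k$ fails, then for every $x_j\in C$ with $x_j\ne x_{s(k)}$ (such an $x_j$ is equivalent to $x_{s(k)}$), a new sensor measuring $x_j$, with the same connectivity as the failed one, restores structural observability and structural distributed observability. 3. If no sensor other than $k$ measures a state of $C$, then without sensor $k$ the system is not structurally observable, and replacing sensor $k$ by one that measures a state outside of $C$ restores neither structural observability nor structural distributed observability. 4. If $C$ consists of the single state $x_{s(k)}$ (a self-loop node), then $x_{s(k)}$ has no equivalent state. 5. There are a fixed program for a unit-cost random access machine (registers and memory cells holding natural numbers; addition, truncated subtraction, loads, stores and zero tests at unit cost) and a constant $c$ such that, for all $n\ge 1$, all real $n\times n$ matrices $A$ and all $i\in\{1,\dots,n\}$, the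 program, given $n$, $i$ and the zero pattern of $A$, halts within $c\,n^2$ steps and outputs labels of the states describing the decomposition of the system digraph into SCCs, together with the set of the states equivalent to $x_i$. -/

import Mathlib

open scoped Kronecker

/-! ### System digraph, strongly connected components, matchings -/

/-- The digraph on the state nodes of `x(k+1) = A x(k)`: there is a link `x_j → x_i` iff
`a_{ij} ≠ 0`. -/
def systemDigraph {n : ℕ} (A : Matrix (Fin n) (Fin n) ℝ) : Digraph (Fin n) where
  Adj j i := A i j ≠ 0

/-- There is a directed path (possibly of length zero) from `u` to `v`. -/
def Digraph.Reaches {V : Type*} (G : Digraph V) (u v : V) : Prop :=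
  Relation.ReflTransGen G.Adj u v

/-- A digraph is strongly connected if every node is reachable from every node. -/
def Digraph.StronglyConnected {V : Type*} (G : Digraph V) : Prop :=
  ∀ u v, G.Reaches u v

/-- `C` is (the node set of) a strongly connected component: it is nonempty, and it consists of
exactly the nodes that are mutually reachable with any one of its nodes. -/
def Digraph.IsSCC {V : Type*} (G : Digraph V) (C : Set V) : Prop :=
  C.Nonempty ∧ ∀ u ∈ C, ∀ v, v ∈ C ↔ G.Reaches u v ∧ G.Reaches v u

/-- A parent SCC is an SCC with no link to a node outside of it. -/
def Digraph.IsParentSCC {V : Type*} (G : Digraph V) (C : Set V) : Prop :=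
  G.IsSCC C ∧ ∀ u ∈ C, ∀ v, v ∉ C → ¬ G.Adj u v

/-- The states equivalent to `i`: the other states that share an SCC with `i`. -/
def Digraph.equivalentStates {V : Type*} (G : Digraph V) (i : V) : Set V :=
  {j | j ≠ i ∧ ∃ C, G.IsSCC C ∧ i ∈ C ∧ j ∈ C}

/-- A matching in the bipartite representation of `G`: a set of links `(u, v)`, `u → v`, no two of
which share their start node or their end node. -/
def Digraph.IsLinkMatching {V : Type*} (G : Digraph V) (M : Finset (V × V)) : Prop :=
  (∀ e ∈ M, G.Adj e.1 e.2) ∧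
    (∀ e ∈ M, ∀ f ∈ M, e.1 = f.1 → e = f) ∧ (∀ e ∈ M, ∀ f ∈ M, e.2 = f.2 → e = f)

/-- A matching with the largest possible number of links. -/
def Digraph.IsMaximumLinkMatching {V : Type*} (G : Digraph V) (M : Finset (V × V)) : Prop :=
  G.IsLinkMatching M ∧ ∀ M', G.IsLinkMatching M' → M'.card ≤ M.card

/-- The unmatched nodes: those that are not the start node of a link of `M`. -/
def unmatched {n : ℕ} (M : Finset (Fin n × Fin n)) : Finset (Fin n) :=
  Finset.univ.filter fun v => ∀ e ∈ M, e.1 ≠ v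

/-! ### Observability -/

/-- Observability of `x(k+1) = A x(k)`, `y(k) = C x(k)`: the outputs determine the initial state. -/
def Observable {ι κ : Type*} [Fintype ι] [DecidableEq ι]
    (A : Matrix ι ι ℝ) (C : Matrix κ ι ℝ) : Prop :=
  ∀ x : ι → ℝ, (∀ k : ℕ, C.mulVec ((A ^ k).mulVec x) = 0) → x = 0

/-- `A` and `A'` have the same zero pattern. -/
def SameStructure {n : ℕ} (A A' : Matrix (Fin n) (Fin n) ℝ) : Prop :=
  ∀ i j, A' i j ≠ 0 ↔ A i j ≠ 0

/-- `H` is a measurement matrix in which the sensor `l` measures exactly the state `s l`. -/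
def MeasuresStates {n : ℕ} {ι : Type*} (s : ι → Fin n) (H : Matrix ι (Fin n) ℝ) : Prop :=
  ∀ l v, H l v ≠ 0 ↔ v = s l

/-- Structural observability of the system with the zero pattern of `A` and with sensors that
measure the states `s l`. -/
def StructurallyObservable {n : ℕ} {ι : Type*} (A : Matrix (Fin n) (Fin n) ℝ)
    (s : ι → Fin n) : Prop :=
  ∃ (A' : Matrix (Fin n) (Fin n) ℝ) (H : Matrix ι (Fin n) ℝ),
    SameStructure A A' ∧ MeasuresStates s H ∧ Observable A' H

/-- `D_H`: the block diagonal matrix whose `i`-th block is the sum of `H_jᵀ H_j` over the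
measurement-fusion neighbourhood `N i` of the sensor `i`. -/
def fusedMeasurement {n : ℕ} {ι : Type*} [DecidableEq ι] (H : Matrix ι (Fin n) ℝ)
    (N : ι → Finset ι) : Matrix (ι × Fin n) (ι × Fin n) ℝ :=
  (Matrix.blockDiagonal fun i => ∑ j ∈ N i, Matrix.vecMulVec (H j) (H j)).submatrix
    Prod.swap Prod.swap

/-- The hub network: every sensor uses its own measurement and those of the hub sensors. -/
def hubNeighborhood {ι : Type*} [DecidableEq ι] (hubs : Finset ι) (i : ι) : Finset ι :=
  insert i hubs

/-- Structural distributed observability: for some numerical values of `A` and of the measurement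
matrix with the prescribed structure, and for some row-stochastic `W` whose nonzero entries `w_{ij}`
are those with a link `j → i` in the prediction-fusion network `Gβ`, the pair
`(W ⊗ A, D_H)` is observable. -/
def DistributedObservable {n : ℕ} {ι : Type*} [Fintype ι] [DecidableEq ι]
    (A : Matrix (Fin n) (Fin n) ℝ) (s : ι → Fin n) (Gβ : Digraph ι) (N : ι → Finset ι) : Prop :=
  ∃ (A' : Matrix (Fin n) (Fin n) ℝ) (H : Matrix ι (Fin n) ℝ) (W : Matrix ι ι ℝ),
    SameStructure A A' ∧ MeasuresStates s H ∧
      W ∈ Matrix.rowStochastic ℝ ι ∧ (∀ i j, W i j ≠ 0 ↔ Gβ.Adj j i) ∧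
      Observable (W ⊗ₖ A') (fusedMeasurement H N)

/-! ### A unit-cost random access machine

Programs are finite and fixed, independent of the input size; every elementary instruction and every
evaluation of a branching condition costs one step. -/

/-- Programs over registers `r₀, r₁, …` and a memory, all holding natural numbers. -/
inductive RamProgram : Type
  /-- `r_x := c` -/
  | const (x c : ℕ)
  /-- `r_x := r_y + r_z` -/
  | add (x y z : ℕ)
  /-- `r_x := r_y - r_z`, truncated at zero -/
  | sub (x y z : ℕ)
  /-- `r_x := mem[r_y]` -/
  | load (x y : ℕ)
  /-- `mem[r_x] := r_y` -/
  | store (x y : ℕ)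
  /-- first `p`, then `q` -/
  | seq (p q : RamProgram)
  /-- `p` if `r_x ≠ 0`, and `q` otherwise -/
  | branch (x : ℕ) (p q : RamProgram)
  /-- repeat `p` as long as `r_x ≠ 0` -/
  | loop (x : ℕ) (p : RamProgram)

/-- The contents of the registers and of the memory. -/
structure RamState : Type where
  reg : ℕ → ℕ
  mem : ℕ → ℕ

/-- Assign a value to a register. -/
def RamState.setReg (σ : RamState) (x v : ℕ) : RamState :=
  { σ with reg := Function.update σ.reg x v }

/-- Assign a value to a memory cell. -/
def RamState.setMem (σ : RamState) (a v : ℕ) : RamState :=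
  { σ with mem := Function.update σ.mem a v }

/-- `RamExec p σ τ t`: started in `σ`, the program `p` halts in `τ` after exactly `t` steps. -/
inductive RamExec : RamProgram → RamState → RamState → ℕ → Prop
  | const (x c : ℕ) (σ : RamState) :
      RamExec (.const x c) σ (σ.setReg x c) 1
  | add (x y z : ℕ) (σ : RamState) :
      RamExec (.add x y z) σ (σ.setReg x (σ.reg y + σ.reg z)) 1
  | sub (x y z : ℕ) (σ : RamState) :
      RamExec (.sub x y z) σ (σ.setReg x (σ.reg y - σ.reg z)) 1
  | load (x y : ℕ) (σ : RamState) :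
      RamExec (.load x y) σ (σ.setReg x (σ.mem (σ.reg y))) 1
  | store (x y : ℕ) (σ : RamState) :
      RamExec (.store x y) σ (σ.setMem (σ.reg x) (σ.reg y)) 1
  | seq {p q : RamProgram} {σ τ ρ : RamState} {t u : ℕ} :
      RamExec p σ τ t → RamExec q τ ρ u → RamExec (.seq p q) σ ρ (t + u)
  | branch_true {x : ℕ} {p q : RamProgram} {σ τ : RamState} {t : ℕ} :
      σ.reg x ≠ 0 → RamExec p σ τ t → RamExec (.branch x p q) σ τ (t + 1)
  | branch_false {x : ℕ} {p q : RamProgram} {σ τ : RamState} {t : ℕ} :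
      σ.reg x = 0 → RamExec q σ τ t → RamExec (.branch x p q) σ τ (t + 1)
  | loop_done {x : ℕ} {p : RamProgram} {σ : RamState} :
      σ.reg x = 0 → RamExec (.loop x p) σ σ 1
  | loop_step {x : ℕ} {p : RamProgram} {σ τ ρ : RamState} {t u : ℕ} :
      σ.reg x ≠ 0 → RamExec p σ τ t → RamExec (.loop x p) τ ρ u →
        RamExec (.loop x p) σ ρ (t + u + 1)

open Classical in
/-- The input: `r₀ = n`, `r₁` is the index of the state `i`, the cells `0, …, n² - 1` hold the zero
pattern of `A` row by row (`mem[u * n + v]` is `1` if `a_{uv} ≠ 0` and `0` otherwise), and all other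
registers and cells are `0`. -/
noncomputable def ramInput {n : ℕ} (A : Matrix (Fin n) (Fin n) ℝ) (i : Fin n) : RamState where
  reg x := if x = 0 then n else if x = 1 then i else 0
  mem a := if ∃ u v : Fin n, a = u * n + v ∧ A u v ≠ 0 then 1 else 0

open Classical in
/-- The program halts on every system matrix `A` and every state `i` within `c * n²` steps; then the
cells `n², …, n² + n - 1` hold labels of the states that give the SCC decomposition of the system
digraph, and the next `n` cells hold the indicator function of the states equivalent to `i`. -/
def FindsEquivalentStates (P : RamProgram) (c : ℕ) : Prop :=
  ∀ (n : ℕ) (A : Matrix (Fin n) (Fin n) ℝ) (i : Fin n), ∃ (τ : RamState) (t : ℕ),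
    RamExec P (ramInput A i) τ t ∧ t ≤ c * n ^ 2 ∧
      (∀ u v : Fin n, τ.mem (n ^ 2 + u) = τ.mem (n ^ 2 + v) ↔
        ∃ C, (systemDigraph A).IsSCC C ∧ u ∈ C ∧ v ∈ C) ∧
      (∀ v : Fin n, τ.mem (n ^ 2 + n + v) =
        if v ∈ (systemDigraph A).equivalentStates i then 1 else 0)

/-! Necessity: a parent SCC is closed under outgoing links, so a vector supported on it stays
supported there under `A'`. If no state of it is measured, such a vector is invisible. The same
holds for `W ⊗ₖ A'` on the product of the sensors with the SCC (`not_observable_of_closed`).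

Sufficiency: extend the matching to a permutation of the states. It uses links of the digraph except
possibly at unmatched states. These are measured, so a vector in the eigenvector test vanishes
there, and their columns may be erased or restored at will (`eraseColumns_mulVec`). It remains to
test a matrix `B` made of the cycles of the permutation, with distinct positive weights, and of one
exit link per cycle that meets no measured state, leading closer to a cycle that does. An
eigenvector of `B` starts at a source cycle whose weight is `‖lam‖`. As the weights differ there is
only one source, and from there the support spreads along the exit links without cancellation,
filling a root cycle and hence hitting a measured state (`CycleForest.eigen_root`). Finally, on the
line from the erased matrix to `A`, all but finitely many points are observable and have the zero
pattern of `A`.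

Distributed case: the hubs force every block of a test vector to vanish on the unmatched states, so
`W ⊗ₖ B` may be tested instead, each sensor using only its own state. `B` is invertible and
diagonalizable. Choose `W` invertible, with no eigenvector having a zero entry, and with spectrum
such that `w * a = w' * a'` forces `a = a'`. Then each eigenvector of `W ⊗ₖ B` is a pure tensor of a
nowhere zero eigenvector of `W` and an eigenvector of `B` that vanishes at all measured states,
hence is zero (`kronecker_eigenvector_eq_zero`). Such a `W` comes from a nonnegative matrix
observable from each single node, normalized by its Perron vector and mixed with the identity
(`exists_rowStochastic_kronecker`).

Replacing the failed sensor inside its parent SCC keeps the hubs and keeps every parent SCC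
measured. Both observability notions then follow.

The equivalent states are found by the path-based SCC algorithm: each step scans one row of length
`n`, and twice the number of unvisited nodes plus the path length drops at every step
(`runs_pathStep`). So there are at most `2 * n + 1` steps of cost `O(n)`. -/

/-! ### The observability Gramian -/

/-- The observability Gramian over the times `0, …, N - 1`. -/
def obsGram {R ι κ : Type*} [CommRing R] [Fintype ι] [DecidableEq ι] [Fintype κ]
    (A : Matrix ι ι R) (C : Matrix κ ι R) (N : ℕ) : Matrix ι ι R :=
  ∑ k ∈ Finset.range N, (C * A ^ k).transpose * (C * A ^ k)

theorem obsGram_map {R S ι κ : Type*} [CommRing R] [CommRing S] [Fintype ι] [DecidableEq ι]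
    [Fintype κ] (f : R →+* S) (A : Matrix ι ι R) (C : Matrix κ ι R) (N : ℕ) :
    (obsGram A C N).map f = obsGram (A.map f) (C.map f) N := by
  have h : ∀ k, (C * A ^ k).map f = C.map f * (A.map f) ^ k := fun k => by
    rw [Matrix.map_mul, ← RingHom.mapMatrix_apply f (A ^ k), map_pow, RingHom.mapMatrix_apply]
  unfold obsGram
  rw [← RingHom.mapMatrix_apply, map_sum]
  refine Finset.sum_congr rfl fun k _ => ?_
  rw [RingHom.mapMatrix_apply, Matrix.map_mul, Matrix.transpose_map, h]

/-- The subspaces with zero output before time `N` decrease with `N`, and such a chain stabilizes in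
finite dimension. -/
theorem Observable.exists_bound {ι κ : Type*} [Fintype ι] [DecidableEq ι]
    {A : Matrix ι ι ℝ} {C : Matrix κ ι ℝ} (h : Observable A C) :
    ∃ N : ℕ, ∀ x : ι → ℝ, (∀ k < N, C.mulVec ((A ^ k).mulVec x) = 0) → x = 0 := by
  let V : ℕ →o (Submodule ℝ (ι → ℝ))ᵒᵈ :=
    { toFun := fun N => OrderDual.toDual
        (⨅ k ∈ Finset.range N, LinearMap.ker (C * A ^ k).mulVecLin)
      monotone' := fun M N hMN => OrderDual.toDual_le_toDual.2
        (biInf_mono fun k hk => Finset.mem_range.2 ((Finset.mem_range.1 hk).trans_le hMN)) }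
  have hV : ∀ N x, x ∈ OrderDual.ofDual (V N) ↔ ∀ k < N, C.mulVec ((A ^ k).mulVec x) = 0 := by
    intro N x
    simp [V, Submodule.mem_iInf, Matrix.mulVec_mulVec]
  obtain ⟨N, hN⟩ := IsArtinian.monotone_stabilizes V
  refine ⟨N, fun x hx => h x fun k => ?_⟩
  have hx' : x ∈ OrderDual.ofDual (V N) := (hV N x).2 hx
  rw [hN (max N (k + 1)) (le_max_left _ _)] at hx'
  exact (hV _ x).1 hx' k (lt_of_lt_of_le (Nat.lt_succ_self k) (le_max_right _ _))

theorem obsGram_mulVec {R ι κ : Type*} [CommRing R] [Fintype ι] [DecidableEq ι] [Fintype κ]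
    (A : Matrix ι ι R) (C : Matrix κ ι R) (N : ℕ) (x : ι → R) :
    (obsGram A C N).mulVec x =
      ∑ k ∈ Finset.range N, (C * A ^ k).transpose.mulVec (C.mulVec ((A ^ k).mulVec x)) := by
  simp [obsGram, Matrix.sum_mulVec, Matrix.mulVec_mulVec, Matrix.mul_assoc]

theorem observable_of_det_obsGram_ne_zero {ι κ : Type*} [Fintype ι] [DecidableEq ι] [Fintype κ]
    {A : Matrix ι ι ℝ} {C : Matrix κ ι ℝ} {N : ℕ} (h : (obsGram A C N).det ≠ 0) :
    Observable A C := by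
  intro x hx
  by_contra hne
  refine h (Matrix.exists_mulVec_eq_zero_iff.1 ⟨x, hne, ?_⟩)
  rw [obsGram_mulVec]
  exact Finset.sum_eq_zero fun k _ => by rw [hx, Matrix.mulVec_zero]

/-- Over `ℝ` the quadratic form of the Gramian is the sum of the squares of the outputs, so a kernel
vector has no output before time `N`. -/
theorem Observable.exists_det_obsGram_ne_zero {ι κ : Type*} [Fintype ι] [DecidableEq ι] [Fintype κ]
    {A : Matrix ι ι ℝ} {C : Matrix κ ι ℝ} (h : Observable A C) :
    ∃ N, (obsGram A C N).det ≠ 0 := by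
  obtain ⟨N, hN⟩ := h.exists_bound
  refine ⟨N, fun hdet => ?_⟩
  obtain ⟨x, hne, hx⟩ := Matrix.exists_mulVec_eq_zero_iff.2 hdet
  refine hne (hN x fun k hk => ?_)
  have h0 : ∑ k ∈ Finset.range N, C.mulVec ((A ^ k).mulVec x) ⬝ᵥ C.mulVec ((A ^ k).mulVec x) = 0 := by
    have := congrArg (fun y => x ⬝ᵥ y) hx
    simp only [obsGram_mulVec, dotProduct_sum, dotProduct_zero] at this
    rw [← this]
    refine Finset.sum_congr rfl fun k _ => ?_
    rw [Matrix.dotProduct_mulVec x, Matrix.vecMul_transpose, Matrix.mulVec_mulVec]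
  exact dotProduct_self_eq_zero.1 ((Finset.sum_eq_zero_iff_of_nonneg fun k _ =>
    Finset.sum_nonneg fun i _ => mul_self_nonneg _).1 h0 k (Finset.mem_range.2 hk))

/-- Observability at one point of a line of system matrices implies it at all but finitely many. -/
theorem Observable.finite_not_line {ι κ : Type*} [Fintype ι] [DecidableEq ι] [Fintype κ]
    {A₀ : Matrix ι ι ℝ} {C : Matrix κ ι ℝ} (h : Observable A₀ C) (B : Matrix ι ι ℝ) :
    {t : ℝ | ¬ Observable (A₀ + t • B) C}.Finite := by
  obtain ⟨N, hN⟩ := h.exists_det_obsGram_ne_zero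
  -- The Gramian of the pencil `A₀ + X B` has a polynomial determinant that is nonzero at `0`; every
  -- exceptional `t` is a root of it.
  let P : Matrix ι ι (Polynomial ℝ) :=
    A₀.map Polynomial.C + (Polynomial.X : Polynomial ℝ) • B.map Polynomial.C
  let q : Polynomial ℝ := (obsGram P (C.map Polynomial.C) N).det
  have hq : ∀ t, q.eval t = (obsGram (A₀ + t • B) C N).det := by
    intro t
    have h1 : P.map (Polynomial.evalRingHom t) = A₀ + t • B := by
      ext i j
      simp [P]
      exact mul_comm _ _
    have h2 : (C.map Polynomial.C).map (Polynomial.evalRingHom t) = C := by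
      ext i j
      simp
    rw [← Polynomial.coe_evalRingHom, RingHom.map_det, RingHom.mapMatrix_apply, obsGram_map, h1, h2]
  have hq0 : q ≠ 0 := by
    intro h0
    apply hN
    have := hq 0
    rw [h0] at this
    simpa using this.symm
  refine (q.rootSet_finite ℝ).subset fun t ht => ?_
  rw [Polynomial.mem_rootSet]
  refine ⟨hq0, ?_⟩
  by_contra hne
  refine ht (observable_of_det_obsGram_ne_zero (N := N) ?_)
  rw [← hq]
  simpa using hne

/-! ### The eigenvector test -/

/-- A real matrix with complex entries. -/
abbrev Matrix.toComplex {ι κ : Type*} (A : Matrix ι κ ℝ) : Matrix ι κ ℂ := A.map Complex.ofReal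

theorem Matrix.toComplex_mulVec {ι κ : Type*} [Fintype κ] (A : Matrix ι κ ℝ) (x : κ → ℝ) :
    A.toComplex.mulVec (fun i => (x i : ℂ)) = fun i => ((A.mulVec x i : ℝ) : ℂ) := by
  ext i
  simp [Matrix.mulVec, dotProduct]

/-- The Popov–Belevitch–Hautus test. -/
theorem observable_of_eigenvector {ι κ : Type*} [Fintype ι] [DecidableEq ι]
    {A : Matrix ι ι ℝ} {C : Matrix κ ι ℝ}
    (h : ∀ (lam : ℂ) (z : ι → ℂ), A.toComplex.mulVec z = lam • z → C.toComplex.mulVec z = 0 →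
      z = 0) : Observable A C := by
  intro x hx
  by_contra hne
  -- The complex unobservable subspace is invariant under `A`; if nonzero, it contains an
  -- eigenvector.
  let N : Submodule ℂ (ι → ℂ) :=
    ⨅ k : ℕ, LinearMap.ker (C.toComplex.mulVecLin ∘ₗ (A.toComplex ^ k).mulVecLin)
  have hN : ∀ z, z ∈ N ↔ ∀ k : ℕ, C.toComplex.mulVec ((A.toComplex ^ k).mulVec z) = 0 := by
    intro z
    simp [N, Submodule.mem_iInf]
  have hpow : ∀ k, (A.toComplex ^ k).mulVec (fun i => (x i : ℂ)) =
      fun i => (((A ^ k).mulVec x i : ℝ) : ℂ) := by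
    intro k
    rw [← Matrix.toComplex_mulVec]
    congr 1
    have := map_pow (Complex.ofRealHom.mapMatrix (m := ι)) A k
    exact this.symm
  have hxN : (fun i => (x i : ℂ)) ∈ N := by
    rw [hN]
    intro k
    rw [hpow, Matrix.toComplex_mulVec, hx k]
    ext
    simp
  have hinv : ∀ z ∈ N, A.toComplex.mulVecLin z ∈ N := by
    intro z hz
    rw [hN] at hz ⊢
    intro k
    rw [Matrix.mulVecLin_apply, Matrix.mulVec_mulVec _ (A.toComplex ^ k), ← pow_succ]
    exact hz (k + 1)
  have : Nontrivial N := by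
    refine ⟨⟨⟨_, hxN⟩, 0, fun h0 => hne ?_⟩⟩
    have := congrArg Subtype.val h0
    ext i
    have := congrFun this i
    simpa using this
  obtain ⟨lam, hlam⟩ := Module.End.exists_eigenvalue (A.toComplex.mulVecLin.restrict hinv)
  obtain ⟨z, hz⟩ := hlam.exists_hasEigenvector
  have h1 := congrArg Subtype.val hz.apply_eq_smul
  have h2 := (hN z).1 z.2 0
  exact hz.2 (Subtype.ext (h lam z h1 (by simpa using h2)))

/-! ### Weighted cycles joined by a forest of links -/

/-- The elements from which `T` is reached in exactly `n` steps of `R`. -/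
def stepsTo {Q : Type*} (R : Q → Q → Prop) (T : Set Q) : ℕ → Set Q
  | 0 => T
  | n + 1 => {q | ∃ q' ∈ stepsTo R T n, R q q'}

/-- The depth is the least number of steps to `T`; the first step of a shortest path decreases it.
-/
theorem exists_depth {Q : Type*} (R : Q → Q → Prop) (T : Set Q)
    (h : ∀ q, ∃ t ∈ T, Relation.ReflTransGen R q t) :
    ∃ depth : Q → ℕ, ∀ q ∉ T, ∃ q', R q q' ∧ depth q' < depth q := by
  classical
  have hD : ∀ q, ∃ n, q ∈ stepsTo R T n := by
    intro q
    obtain ⟨t, ht, hqt⟩ := h q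
    induction hqt using Relation.ReflTransGen.head_induction_on with
    | refl => exact ⟨0, ht⟩
    | head hab _ ih =>
      obtain ⟨n, hn⟩ := ih
      exact ⟨n + 1, _, hn, hab⟩
  refine ⟨fun q => Nat.find (hD q), fun q hq => ?_⟩
  have hs := Nat.find_spec (hD q)
  rcases hn : Nat.find (hD q) with _ | n
  · rw [hn] at hs
    exact absurd hs hq
  · rw [hn] at hs
    obtain ⟨q', hq', hR⟩ := hs
    refine ⟨q', hR, ?_⟩
    simp only [hn]
    exact Nat.lt_succ_of_le (Nat.find_min' (hD q') hq')

/-- The cycles of a permutation with distinct positive weights, where every cycle outside of `T` has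
one exit link, to a cycle of smaller depth. -/
structure CycleForest (V Q : Type*) where
  perm : Equiv.Perm V
  cyc : V → Q
  cyc_perm : ∀ v, cyc (perm v) = cyc v
  sameCycle : ∀ u v, cyc u = cyc v → perm.SameCycle u v
  T : Set Q
  tail : Q → V
  head : Q → V
  depth : Q → ℕ
  cyc_tail : ∀ q ∉ T, cyc (tail q) = q
  depth_head : ∀ q ∉ T, depth (cyc (head q)) < depth q
  weight : Q → ℝ
  weight_pos : ∀ q, 0 < weight q
  weight_inj : Function.Injective weight

namespace CycleForest

variable {V Q : Type*} (F : CycleForest V Q)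

/-- The exit links. -/
def Link (u v : V) : Prop := F.cyc u ∉ F.T ∧ F.tail (F.cyc u) = u ∧ F.head (F.cyc u) = v

/-- The relation that leads from a cycle to the end of its exit link. -/
def Next (q q' : Q) : Prop := ∃ u v, F.Link u v ∧ F.cyc u = q ∧ F.cyc v = q'

theorem Link.depth_lt {F : CycleForest V Q} {u v : V} (h : F.Link u v) :
    F.depth (F.cyc v) < F.depth (F.cyc u) := by
  have := F.depth_head _ h.1
  rwa [h.2.2] at this

theorem next_rightUnique : Relator.RightUnique F.Next := by
  rintro _ _ _ ⟨u, v, h, rfl, rfl⟩ ⟨u', v', h', hu, rfl⟩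
  rw [← h.2.2, ← h'.2.2, hu]

theorem depth_le_of_next {q q' : Q} (h : Relation.ReflTransGen F.Next q q') :
    F.depth q' ≤ F.depth q := by
  induction h with
  | refl => rfl
  | tail _ h ih =>
    obtain ⟨u, v, h, rfl, rfl⟩ := h
    exact h.depth_lt.le.trans ih

theorem exists_next_mem (q : Q) : ∃ t ∈ F.T, Relation.ReflTransGen F.Next q t := by
  induction hd : F.depth q using Nat.strong_induction_on generalizing q with
  | _ d ih =>
    by_cases hq : q ∈ F.T
    · exact ⟨q, hq, .refl⟩
    · obtain ⟨t, ht, h⟩ := ih _ (hd ▸ F.depth_head q hq) _ rfl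
      refine ⟨t, ht, .head ⟨F.tail q, F.head q, ?_, F.cyc_tail q hq, rfl⟩ h⟩
      rw [Link, F.cyc_tail q hq]
      exact ⟨hq, rfl, rfl⟩

theorem exists_pow_eq [Finite V] {u v : V} (h : F.cyc u = F.cyc v) : ∃ k : ℕ, (F.perm ^ k) u = v :=
  let ⟨k, _, hk⟩ := (F.sameCycle u v h).exists_pow_eq'
  ⟨k, hk⟩

theorem cyc_perm_pow (k : ℕ) (v : V) : F.cyc ((F.perm ^ k) v) = F.cyc v := by
  induction k with
  | zero => rfl
  | succ k ih => rw [pow_succ', Equiv.Perm.mul_apply, F.cyc_perm, ih]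

/-- A polynomial with distinct roots that annihilates the weighted adjacency matrix. -/
noncomputable def poly [Fintype Q] : Polynomial ℝ :=
  ∏ q, (Polynomial.X ^ orderOf F.perm - Polynomial.C (F.weight q ^ orderOf F.perm))

/-- Each factor is separable, and two factors differ by a nonzero constant, which makes them
coprime. -/
theorem poly_separable [Finite V] [Fintype Q] : F.poly.Separable := by
  have hN : orderOf F.perm ≠ 0 := (orderOf_pos F.perm).ne'
  refine Polynomial.separable_prod (fun q q' hqq => ?_) fun q =>
    Polynomial.separable_X_pow_sub_C _ (by exact_mod_cast hN) (pow_ne_zero _ (F.weight_pos q).ne')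
  have hne : F.weight q' ^ orderOf F.perm - F.weight q ^ orderOf F.perm ≠ 0 := by
    rw [sub_ne_zero]
    intro h
    exact hqq (F.weight_inj
      ((pow_left_inj₀ (F.weight_pos _).le (F.weight_pos _).le hN).1 h)).symm
  refine ⟨Polynomial.C (F.weight q' ^ orderOf F.perm - F.weight q ^ orderOf F.perm)⁻¹,
    -Polynomial.C (F.weight q' ^ orderOf F.perm - F.weight q ^ orderOf F.perm)⁻¹, ?_⟩
  have : (Polynomial.C (F.weight q' ^ orderOf F.perm - F.weight q ^ orderOf F.perm)⁻¹ *
      Polynomial.C (F.weight q' ^ orderOf F.perm - F.weight q ^ orderOf F.perm) : Polynomial ℝ) =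
      1 := by
    rw [← Polynomial.C_mul, inv_mul_cancel₀ hne, Polynomial.C_1]
  rw [← this, Polynomial.C_sub (a := F.weight q' ^ orderOf F.perm)]
  ring

open Classical in
/-- The weighted adjacency matrix. -/
noncomputable def matrix : Matrix V V ℝ := fun v u =>
  (if v = F.perm u then F.weight (F.cyc u) else 0) + if F.Link u v then 1 else 0

theorem matrix_ne_zero {u v : V} (h : F.matrix v u ≠ 0) : v = F.perm u ∨ F.Link u v := by
  classical
  by_contra! hn
  exact h (by simp [matrix, hn.1, hn.2])

variable [Fintype V]

open Classical in
-- The field is left general because the formula serves complex eigenvectors as well as the real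
-- vectors in the proof of `aeval_poly`.
theorem matrix_mulVec_perm {K : Type*} [Field K] (f : ℝ →+* K) (x : V → K) (u : V) :
    (F.matrix.map f).mulVec x (F.perm u) =
      f (F.weight (F.cyc u)) * x u + ∑ w, if F.Link w (F.perm u) then x w else 0 := by
  simp only [Matrix.mulVec, dotProduct, matrix, Matrix.map_apply, map_add, add_mul,
    Finset.sum_add_distrib]
  congr 1
  · rw [Finset.sum_eq_single u]
    · simp
    · intro w _ hw
      rw [if_neg (fun h => hw (F.perm.injective h).symm)]
      simp
    · simp
  · refine Finset.sum_congr rfl fun w _ => ?_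
    split_ifs <;> simp

theorem matrix_mulVec_perm_of_forall {K : Type*} [Field K] (f : ℝ →+* K) (x : V → K) (u : V)
    (h : ∀ w, F.Link w (F.perm u) → x w = 0) :
    (F.matrix.map f).mulVec x (F.perm u) = f (F.weight (F.cyc u)) * x u := by
  classical
  rw [matrix_mulVec_perm, Finset.sum_eq_zero, add_zero]
  intro w _
  split_ifs with hw
  · exact h w hw
  · rfl

section Eigenvector

variable {lam : ℂ} {x : V → ℂ} (hx : F.matrix.toComplex.mulVec x = lam • x)

include hx

theorem eigen_eq_of_forall {u : V} (h : ∀ w, F.Link w (F.perm u) → x w = 0) :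
    lam * x (F.perm u) = F.weight (F.cyc u) * x u := by
  have := F.matrix_mulVec_perm_of_forall Complex.ofRealHom x u h
  have h2 := congrFun hx (F.perm u)
  rw [Pi.smul_apply, smul_eq_mul] at h2
  rw [← h2]
  exact this

/-- On a cycle without input, each step multiplies by weight over `lam`. After as many steps as the
order of the permutation one is back at the start, so the same powers of `lam` and of the weight
agree. -/
theorem eigen_source {q : Q} (h : ∀ v, F.cyc v = q → ∀ w, F.Link w v → x w = 0)
    {u : V} (hu : F.cyc u = q) (hne : x u ≠ 0) :
    ‖lam‖ = F.weight q ∧ ∀ v, F.cyc v = q → x v ≠ 0 := by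
  subst hu
  have hk : ∀ k : ℕ, lam ^ k * x ((F.perm ^ k) u) = (F.weight (F.cyc u) : ℂ) ^ k * x u := by
    intro k
    induction k with
    | zero => simp
    | succ k ih =>
      have := F.eigen_eq_of_forall hx (u := (F.perm ^ k) u) fun w hw =>
        h _ (by rw [F.cyc_perm, F.cyc_perm_pow]) w hw
      rw [F.cyc_perm_pow] at this
      rw [pow_succ' F.perm, Equiv.Perm.mul_apply, pow_succ, mul_assoc, this, mul_left_comm, ih]
      ring
  have hw : (F.weight (F.cyc u) : ℂ) ≠ 0 := by exact_mod_cast (F.weight_pos _).ne'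
  constructor
  · have h1 := hk (orderOf F.perm)
    rw [pow_orderOf_eq_one, Equiv.Perm.one_apply] at h1
    have h2 := congrArg norm (mul_right_cancel₀ hne h1)
    rw [norm_pow, norm_pow, Complex.norm_real, Real.norm_of_nonneg (F.weight_pos _).le] at h2
    exact (pow_left_inj₀ (norm_nonneg _) (F.weight_pos _).le (orderOf_pos F.perm).ne').1 h2
  · intro v hv h0
    obtain ⟨k, rfl⟩ := F.exists_pow_eq hv.symm
    have := hk k
    rw [h0, mul_zero] at this
    exact mul_ne_zero (pow_ne_zero k hw) hne this.symm

/-- The only input enters at `v₀`. A zero on the cycle propagates backwards to `v₀`, as the weight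
is nonzero, and from there forwards over the whole cycle, as `lam ≠ 0`. The equation at `v₀` then
forces `x w₀ = 0`. -/
theorem eigen_driven {q : Q} (hlam : lam ≠ 0) {w₀ v₀ : V} (h₀ : F.Link w₀ v₀) (hv₀ : F.cyc v₀ = q)
    (hw₀ : x w₀ ≠ 0)
    (h : ∀ v, F.cyc v = q → ∀ w, F.Link w v → x w ≠ 0 → w = w₀) :
    ∀ v, F.cyc v = q → x v ≠ 0 := by
  classical
  have hu : ∀ v, F.cyc v = q → ∀ w, w ≠ w₀ → F.Link w v → x w = 0 := fun v hv w hw hl => by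
    by_contra hne
    exact hw (h v hv w hl hne)
  have hstep : ∀ u, F.cyc u = q → F.perm u ≠ v₀ →
      lam * x (F.perm u) = F.weight (F.cyc u) * x u := by
    intro u hcu hne
    refine F.eigen_eq_of_forall hx fun w hw => ?_
    by_contra hxw
    have := h _ (by rw [F.cyc_perm, hcu]) w hw hxw
    subst this
    exact hne (hw.2.2.symm.trans h₀.2.2)
  have hzero : ∀ u, F.cyc u = q → F.perm u ≠ v₀ → x (F.perm u) = 0 → x u = 0 := by
    intro u hcu hne h0
    have := hstep u hcu hne
    rw [h0, mul_zero] at this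
    have hw : (F.weight (F.cyc u) : ℂ) ≠ 0 := by exact_mod_cast (F.weight_pos _).ne'
    exact (mul_eq_zero.1 this.symm).resolve_left hw
  have hback : ∀ k : ℕ, x ((F.perm ^ k) v₀) = 0 → x v₀ = 0 := by
    intro k
    induction k with
    | zero => exact id
    | succ k ih =>
      intro h0
      rw [pow_succ', Equiv.Perm.mul_apply] at h0
      by_cases hk : F.perm ((F.perm ^ k) v₀) = v₀
      · rwa [hk] at h0
      · exact ih (hzero _ (by rw [F.cyc_perm_pow, hv₀]) hk h0)
  have hforth : x v₀ = 0 → ∀ k : ℕ, x ((F.perm ^ k) v₀) = 0 := by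
    intro h0 k
    induction k with
    | zero => exact h0
    | succ k ih =>
      rw [pow_succ', Equiv.Perm.mul_apply]
      by_cases hk : F.perm ((F.perm ^ k) v₀) = v₀
      · rwa [hk]
      · have := hstep _ (by rw [F.cyc_perm_pow, hv₀]) hk
        rw [ih, mul_zero] at this
        exact (mul_eq_zero.1 this).resolve_left hlam
  intro v hv h0
  obtain ⟨k, rfl⟩ := F.exists_pow_eq (hv₀.trans hv.symm)
  have hall := hforth (hback k h0)
  have hsymm : F.cyc (F.perm.symm v₀) = F.cyc v₀ := by
    rw [← F.cyc_perm, Equiv.apply_symm_apply]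
  obtain ⟨j, hj⟩ := F.exists_pow_eq hsymm.symm
  have h1 := F.matrix_mulVec_perm Complex.ofRealHom x (F.perm.symm v₀)
  have h2 := congrFun hx v₀
  rw [Equiv.apply_symm_apply, Finset.sum_eq_single w₀, if_pos h₀] at h1
  · have h3 := h1.symm.trans h2
    have h4 : x v₀ = 0 := hall 0
    rw [← hj, hall j, Pi.smul_apply, h4, mul_zero, smul_zero, zero_add] at h3
    exact hw₀ h3
  · intro w _ hw
    split_ifs with hl
    · exact hu v₀ hv₀ w hw hl
    · rfl
  · simp

/-- An eigenvector is nonzero on all of some cycle in `T`. -/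
theorem eigen_root [Finite Q] (hne : x ≠ 0) :
    lam ≠ 0 ∧ ∃ q ∈ F.T, ∀ v, F.cyc v = q → x v ≠ 0 := by
  obtain ⟨u₁, hu₁⟩ := Function.ne_iff.1 hne
  -- Links lower the depth, so a cycle of maximal depth in the support receives no input, and its
  -- weight is `‖lam‖`.
  obtain ⟨u₀, hu₀, hmax⟩ := Set.exists_max_image {u | x u ≠ 0} (fun u => F.depth (F.cyc u))
    (Set.toFinite _) ⟨u₁, hu₁⟩
  have hsrc := F.eigen_source hx (q := F.cyc u₀) (fun v hv w hw => by
    by_contra h0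
    have := hmax w h0
    have h1 := hw.depth_lt
    rw [hv] at h1
    omega) rfl hu₀
  have hlam : lam ≠ 0 := by
    rintro rfl
    have := hsrc.1
    rw [norm_zero] at this
    exact (F.weight_pos _).ne this
  -- A cycle in the support either has no input, and is then the cycle of `u₀` because the weights
  -- are distinct, or is fed by a deeper cycle in the support.
  have hchain : ∀ u, x u ≠ 0 → Relation.ReflTransGen F.Next (F.cyc u₀) (F.cyc u) := by
    intro u
    induction hd : F.depth (F.cyc u₀) - F.depth (F.cyc u) using Nat.strong_induction_on
      generalizing u with
    | _ d ih =>
      intro hu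
      by_cases hin : ∀ v, F.cyc v = F.cyc u → ∀ w, F.Link w v → x w = 0
      · have h1 := (F.eigen_source hx hin rfl hu).1
        rw [F.weight_inj (hsrc.1.symm.trans h1)]
      · push Not at hin
        obtain ⟨v, hv, w, hw, hxw⟩ := hin
        have h1 := hw.depth_lt
        have h2 := hmax w hxw
        rw [hv] at h1
        refine .tail (ih _ ?_ w rfl hxw) ⟨w, v, hw, rfl, hv⟩
        omega
  have hnz : ∀ q, Relation.ReflTransGen F.Next (F.cyc u₀) q → ∀ v, F.cyc v = q → x v ≠ 0 := by
    intro q hq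
    induction hq with
    | refl => exact hsrc.2
    | @tail q' q hq' hqq ih =>
      obtain ⟨w₀, v₀, hl, rfl, hv₀⟩ := hqq
      refine F.eigen_driven hx hlam hl hv₀ (ih _ rfl) fun v hv w hw hxw => ?_
      -- Two active links into `q` start on one chain. If their cycles differed, the later one would
      -- lie at or beyond `q` on the chain, hence not be deeper than `q`, although its own link to
      -- `q` lowers the depth.
      have hlt : ∀ a b a' b' : V, F.Link a a' → F.Link b b' → F.cyc a' = q → F.cyc b' = q →
          Relation.ReflTransGen F.Next (F.cyc a) (F.cyc b) → F.cyc a = F.cyc b := by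
        intro a b a' b' ha hb ha' hb' hab
        rcases Relation.ReflTransGen.cases_head hab with h | ⟨r, hr, hrb⟩
        · exact h
        · have : r = q := F.next_rightUnique hr ⟨a, a', ha, rfl, ha'⟩
          have h1 := F.depth_le_of_next hrb
          have h2 := hb.depth_lt
          rw [hb'] at h2
          rw [this] at h1
          omega
      have hcyc : F.cyc w = F.cyc w₀ := by
        rcases Relation.ReflTransGen.total_of_right_unique F.next_rightUnique hq'
          (hchain w hxw) with h | h
        · exact (hlt w₀ w v₀ v hl hw hv₀ hv h).symm
        · exact hlt w w₀ v v₀ hw hl hv hv₀ h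
      rw [← hw.2.1, hcyc, hl.2.1]
  obtain ⟨t, ht, h⟩ := F.exists_next_mem (F.cyc u₀)
  exact ⟨hlam, t, ht, hnz t h⟩

end Eigenvector

variable [DecidableEq V]

/-- Induction on `S`, which is closed under links. The deepest cycle of `S` receives nothing from
`S`, so its factor annihilates the coordinates there and leaves a vector supported on the rest,
which is again closed. -/
theorem aeval_prod_mulVec [DecidableEq Q] (S : Finset Q)
    (hS : ∀ u v, F.Link u v → F.cyc u ∈ S → F.cyc v ∈ S) (x : V → ℝ)
    (hx : ∀ v, F.cyc v ∉ S → x v = 0) :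
    (Polynomial.aeval F.matrix (∏ q ∈ S,
      (Polynomial.X ^ orderOf F.perm - Polynomial.C (F.weight q ^ orderOf F.perm)))).mulVec x
      = 0 := by
  induction hn : S.card generalizing S x with
  | zero =>
    rw [Finset.card_eq_zero] at hn
    subst hn
    have : x = 0 := funext fun v => hx v (by simp)
    rw [this, Matrix.mulVec_zero]
  | succ n ih =>
    obtain ⟨q, hq, hmax⟩ := S.exists_max_image F.depth (Finset.card_pos.1 (by omega))
    rw [← Finset.prod_erase_mul S _ hq, map_mul, ← Matrix.mulVec_mulVec]
    have hinv : ∀ y : V → ℝ, (∀ v, F.cyc v ∉ S → y v = 0) →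
        (∀ v, F.cyc v ∉ S → F.matrix.mulVec y v = 0) ∧
        ∀ u, F.cyc u = q → F.matrix.mulVec y (F.perm u) = F.weight q * y u := by
      intro y hy
      have key : ∀ u, (∀ w, F.Link w (F.perm u) → y w = 0) →
          F.matrix.mulVec y (F.perm u) = F.weight (F.cyc u) * y u := fun u h => by
        have := F.matrix_mulVec_perm_of_forall (RingHom.id ℝ) y u h
        simpa using this
      constructor
      · intro v hv
        obtain ⟨u, rfl⟩ := F.perm.surjective v
        rw [key u, hy u (by rwa [F.cyc_perm] at hv), mul_zero]
        intro w hw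
        exact hy w fun hwS => hv (hS _ _ hw hwS)
      · intro u hu
        rw [key u, hu]
        intro w hw
        refine hy w fun hwS => ?_
        have h1 := hw.depth_lt
        have h2 := hmax _ hwS
        rw [F.cyc_perm, hu] at h1
        omega
    have hpow : ∀ k : ℕ, (∀ v, F.cyc v ∉ S → (F.matrix ^ k).mulVec x v = 0) ∧
        ∀ u, F.cyc u = q → (F.matrix ^ k).mulVec x ((F.perm ^ k) u) = F.weight q ^ k * x u := by
      intro k
      induction k with
      | zero => simpa using hx
      | succ k ihk =>
        have := hinv _ ihk.1
        simp only [Matrix.mulVec_mulVec, ← pow_succ'] at this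
        refine ⟨this.1, fun u hu => ?_⟩
        rw [pow_succ' F.perm, Equiv.Perm.mul_apply,
          this.2 _ (by rw [F.cyc_perm_pow, hu]), ihk.2 u hu]
        ring
    refine ih (S.erase q) ?_ _ ?_ (by rw [Finset.card_erase_of_mem hq, hn]; rfl)
    · intro u v hl hu
      rw [Finset.mem_erase] at hu ⊢
      refine ⟨fun h => ?_, hS u v hl hu.2⟩
      have h1 := hl.depth_lt
      have h2 := hmax _ hu.2
      rw [h] at h1
      omega
    · intro v hv
      have hval : (Polynomial.aeval F.matrix (Polynomial.X ^ orderOf F.perm -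
          Polynomial.C (F.weight q ^ orderOf F.perm))).mulVec x v =
          (F.matrix ^ orderOf F.perm).mulVec x v - F.weight q ^ orderOf F.perm * x v := by
        rw [map_sub, map_pow, Polynomial.aeval_X, Polynomial.aeval_C, Matrix.sub_mulVec,
          Pi.sub_apply, Algebra.algebraMap_eq_smul_one, Matrix.smul_mulVec, Matrix.one_mulVec,
          Pi.smul_apply, smul_eq_mul]
      rw [hval]
      by_cases hvS : F.cyc v ∈ S
      · have hvq : F.cyc v = q := by
          by_contra h
          exact hv (Finset.mem_erase.2 ⟨h, hvS⟩)
        have := (hpow (orderOf F.perm)).2 v hvq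
        rw [pow_orderOf_eq_one, Equiv.Perm.one_apply] at this
        rw [this, sub_self]
      · rw [(hpow _).1 v hvS, hx v hvS, mul_zero, sub_zero]

theorem aeval_poly [Fintype Q] : Polynomial.aeval F.matrix F.poly = 0 := by
  classical
  refine Matrix.ext_of_mulVec_single fun i => ?_
  rw [Matrix.zero_mulVec]
  exact F.aeval_prod_mulVec Finset.univ (fun _ _ _ _ => Finset.mem_univ _) _
    fun v hv => absurd (Finset.mem_univ _) hv

end CycleForest

/-- The roots of the forest are the cycles that meet `Y`, the depth is the distance to them between
cycles, and an enumeration of the cycles supplies distinct weights. This serves both the system,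
with a permutation extending the matching, and the sensor network, with the identity. -/
theorem exists_matrix_of_perm {V : Type*} [Fintype V] [DecidableEq V] (E : V → V → Prop)
    (σ : Equiv.Perm V) (Y : Set V) (hY : ∀ v, ∃ y ∈ Y, Relation.ReflTransGen E v y) :
    ∃ A : Matrix V V ℝ, (∀ u v, A v u ≠ 0 → E u v ∨ v = σ u) ∧
      (∀ (lam : ℂ) (z : V → ℂ), A.toComplex.mulVec z = lam • z → (∀ y ∈ Y, z y = 0) → z = 0) ∧
      (∀ z : V → ℂ, A.toComplex.mulVec z = 0 → z = 0) ∧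
      ∃ p : Polynomial ℝ, p.Separable ∧ Polynomial.aeval A p = 0 := by
  classical
  let Q := Quotient (Equiv.Perm.SameCycle.setoid σ)
  let c : V → Q := Quotient.mk _
  have hc : ∀ u v, c u = c v ↔ σ.SameCycle u v := fun u v => Quotient.eq
  obtain ⟨depth, hdepth⟩ := exists_depth (fun q q' => ∃ u v, E u v ∧ c u = q ∧ c v = q') (c '' Y) (by
    intro q
    obtain ⟨v, rfl⟩ : ∃ v, c v = q := Quotient.exists_rep q
    obtain ⟨y, hy, hvy⟩ := hY v
    exact ⟨c y, ⟨y, hy, rfl⟩, hvy.lift c fun a b h => ⟨a, b, h, rfl, rfl⟩⟩)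
  have hexit : ∀ q : Q, ∃ e : V × V, q ∉ c '' Y →
      E e.1 e.2 ∧ c e.1 = q ∧ depth (c e.2) < depth q := by
    intro q
    by_cases hq : q ∈ c '' Y
    · obtain ⟨v, -⟩ : ∃ v, c v = q := Quotient.exists_rep q
      exact ⟨(v, v), fun h => absurd hq h⟩
    · obtain ⟨q', ⟨u, v, h, hu, rfl⟩, hd⟩ := hdepth q hq
      exact ⟨(u, v), fun _ => ⟨h, hu, hd⟩⟩
  choose e he using hexit
  let F : CycleForest V Q :=
    { perm := σ
      cyc := c
      cyc_perm := fun v => (hc _ _).2 (Equiv.Perm.sameCycle_apply_left.2 (.refl _ _))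
      sameCycle := fun u v h => (hc u v).1 h
      T := c '' Y
      tail := fun q => (e q).1
      head := fun q => (e q).2
      depth := depth
      cyc_tail := fun q hq => (he q hq).2.1
      depth_head := fun q hq => (he q hq).2.2
      weight := fun q => ((Fintype.equivFin Q q : ℕ) : ℝ) + 1
      weight_pos := fun q => by positivity
      weight_inj := fun q q' h => by
        have h' : ((Fintype.equivFin Q q : ℕ) : ℝ) = (Fintype.equivFin Q q' : ℕ) := by
          simpa using h
        exact (Fintype.equivFin Q).injective (Fin.ext (by exact_mod_cast h')) }
  refine ⟨F.matrix, fun u v h => ?_, fun lam z hz hzY => ?_, fun z hz => ?_, F.poly,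
    F.poly_separable, F.aeval_poly⟩
  · rcases F.matrix_ne_zero h with h | ⟨h1, h2, h3⟩
    · exact Or.inr h
    · have := (he _ h1).1
      left
      rwa [show (e (F.cyc u)).1 = u from h2, show (e (F.cyc u)).2 = v from h3] at this
  · by_contra hne
    obtain ⟨-, q, ⟨y, hy, rfl⟩, hq⟩ := F.eigen_root hz hne
    exact hq y rfl (hzY y hy)
  · by_contra hne
    exact (F.eigen_root (lam := 0) (by rw [zero_smul]; exact hz) hne).1 rfl

/-- A matching extends to a permutation of the nodes. -/
theorem Digraph.IsLinkMatching.exists_perm {V : Type*} [Fintype V] [DecidableEq V] {G : Digraph V}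
    {M : Finset (V × V)} (hM : G.IsLinkMatching M) : ∃ σ : Equiv.Perm V, ∀ e ∈ M, σ e.1 = e.2 := by
  classical
  let f : V → V := fun u => if h : ∃ v, (u, v) ∈ M then h.choose else u
  have hf : ∀ e ∈ M, f e.1 = e.2 := by
    intro e he
    have h : ∃ v, (e.1, v) ∈ M := ⟨e.2, he⟩
    have h1 : f e.1 = h.choose := dif_pos h
    rw [h1]
    exact congrArg Prod.snd (hM.2.1 _ h.choose_spec _ he rfl)
  obtain ⟨g, hg⟩ := Finset.exists_equiv_extend_of_card_eq (t := (Finset.univ : Finset V))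
    (s := M.image Prod.fst) (f := f) (by simp) (Finset.subset_univ _) (by
      intro a ha b hb hab
      simp only [Finset.coe_image, Set.mem_image, Finset.mem_coe] at ha hb
      obtain ⟨e, he, rfl⟩ := ha
      obtain ⟨e', he', rfl⟩ := hb
      rw [hf e he, hf e' he'] at hab
      rw [hM.2.2 e he e' he' hab])
  refine ⟨g.trans (Equiv.subtypeUnivEquiv fun v => Finset.mem_univ v), fun e he => ?_⟩
  rw [← hf e he]
  exact hg _ (Finset.mem_image_of_mem _ he)

/-- If every parent SCC contains a node with a property, then a node with this property is reachable
from everywhere. -/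
theorem Digraph.exists_reaches_of_parentSCC {V : Type*} [Finite V] (G : Digraph V) (P : V → Prop)
    (hP : ∀ D, G.IsParentSCC D → ∃ y ∈ D, P y) (v : V) : ∃ y, P y ∧ G.Reaches v y := by
  -- Among the nodes reachable from `v`, one with the smallest set of successors: by minimality that
  -- set is a parent SCC.
  obtain ⟨w, hvw, hmin⟩ := Set.exists_min_image {w | G.Reaches v w}
    (fun w => Set.ncard {x | G.Reaches w x}) (Set.toFinite _) ⟨v, Relation.ReflTransGen.refl⟩
  have hback : ∀ x, G.Reaches w x → G.Reaches x w := by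
    intro x hx
    have hsub : {y | G.Reaches x y} ⊆ {y | G.Reaches w y} := fun y hy => hx.trans hy
    have := Set.eq_of_subset_of_ncard_le hsub (hmin x (Relation.ReflTransGen.trans hvw hx))
      (Set.toFinite _)
    have hw : w ∈ {y | G.Reaches w y} := Relation.ReflTransGen.refl
    rwa [← this] at hw
  obtain ⟨y, hy, hPy⟩ := hP {x | G.Reaches w x}
    ⟨⟨⟨w, Relation.ReflTransGen.refl⟩, fun u hu x =>
      ⟨fun hx => ⟨(hback u hu).trans hx, (hback x hx).trans hu⟩, fun hx => hu.trans hx.1⟩⟩,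
      fun u hu x hx hux => hx (hu.tail hux)⟩
  exact ⟨y, hPy, Relation.ReflTransGen.trans hvw hy⟩

/-! ### Structural observability -/

/-- The matrix with the columns of the nodes in `U` erased. -/
def eraseColumns {V : Type*} [DecidableEq V] (U : Finset V) (B : Matrix V V ℝ) : Matrix V V ℝ :=
  fun v u => if u ∈ U then 0 else B v u

theorem eraseColumns_mulVec {V : Type*} [Fintype V] [DecidableEq V] (U : Finset V)
    (B : Matrix V V ℝ) (z : V → ℂ) (hz : ∀ u ∈ U, z u = 0) :
    (eraseColumns U B).toComplex.mulVec z = B.toComplex.mulVec z := by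
  ext v
  simp only [Matrix.mulVec, dotProduct, Matrix.map_apply]
  refine Finset.sum_congr rfl fun u _ => ?_
  by_cases hu : u ∈ U
  · simp [hz u hu]
  · simp [eraseColumns, hu]

/-- At a matched node the permutation follows a link of the matching, so only columns of unmatched
nodes can carry entries outside the pattern of `A`. -/
theorem exists_matrix_of_matching {n : ℕ} {A : Matrix (Fin n) (Fin n) ℝ}
    {M : Finset (Fin n × Fin n)} (hM : (systemDigraph A).IsLinkMatching M) {ι : Type*}
    (r : ι → Fin n) (hreach : ∀ v, ∃ l, (systemDigraph A).Reaches v (r l)) :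
    ∃ B : Matrix (Fin n) (Fin n) ℝ, (∀ v u, eraseColumns (unmatched M) B v u ≠ 0 → A v u ≠ 0) ∧
      (∀ (lam : ℂ) (z : Fin n → ℂ), B.toComplex.mulVec z = lam • z → (∀ l, z (r l) = 0) → z = 0) ∧
      (∀ z : Fin n → ℂ, B.toComplex.mulVec z = 0 → z = 0) ∧
      ∃ p : Polynomial ℝ, p.Separable ∧ Polynomial.aeval B p = 0 := by
  obtain ⟨σ, hσ⟩ := hM.exists_perm
  obtain ⟨B, h1, h2, h3⟩ := exists_matrix_of_perm (systemDigraph A).Adj σ (Set.range r)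
    (fun v => let ⟨l, hl⟩ := hreach v; ⟨_, ⟨l, rfl⟩, hl⟩)
  refine ⟨B, fun v u h => ?_, fun lam z hz hr => h2 lam z hz (by rintro _ ⟨l, rfl⟩; exact hr l), h3⟩
  by_cases hu : u ∈ unmatched M
  · simp [eraseColumns, hu] at h
  · simp only [eraseColumns, hu, if_false] at h
    rcases h1 u v h with h | h
    · exact h
    · simp only [unmatched, Finset.mem_filter, Finset.mem_univ, true_and, not_forall, not_not]
        at hu
      obtain ⟨e, he, rfl⟩ := hu
      rw [h, hσ e he]
      exact hM.1 e he

open Filter Topology in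
/-- Almost all points of a line through `A` have the zero pattern of `A`, if some point has a smaller
support. -/
theorem eventually_sameStructure {n : ℕ} {A B : Matrix (Fin n) (Fin n) ℝ}
    (h : ∀ v u, B v u ≠ 0 → A v u ≠ 0) :
    ∀ᶠ t : ℝ in cofinite, SameStructure A (B + t • (A - B)) := by
  simp only [SameStructure, eventually_all]
  intro v u
  by_cases hA : A v u = 0
  · have hB : B v u = 0 := by
      by_contra hB
      exact h v u hB hA
    exact Eventually.of_forall fun t => by simp [hA, hB]
  · have hfin : {t : ℝ | B v u + t * (A v u - B v u) = 0}.Finite := by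
      refine Set.Subsingleton.finite fun t ht t' ht' => ?_
      replace ht : B v u + t * (A v u - B v u) = 0 := ht
      replace ht' : B v u + t' * (A v u - B v u) = 0 := ht'
      have hne : A v u - B v u ≠ 0 := by
        intro h0
        rw [h0, mul_zero, add_zero] at ht
        exact hA (by rw [sub_eq_zero.1 h0, ht])
      exact mul_right_cancel₀ hne (by linarith)
    filter_upwards [hfin.compl_mem_cofinite] with t ht
    simp only [Matrix.add_apply, Matrix.smul_apply, Matrix.sub_apply, smul_eq_mul]
    exact ⟨fun _ => hA, fun _ => ht⟩

/-- The measurement matrix with unit entries. -/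
def unitMeasurement {V ι : Type*} [DecidableEq V] (s : ι → V) : Matrix ι V ℝ :=
  fun l v => if v = s l then 1 else 0

theorem measuresStates_unitMeasurement {n : ℕ} {ι : Type*} (s : ι → Fin n) :
    MeasuresStates s (unitMeasurement s) := by
  intro l v
  simp [unitMeasurement]

theorem unitMeasurement_mulVec {V ι : Type*} [Fintype V] [DecidableEq V] (s : ι → V) (z : V → ℂ)
    (l : ι) : (unitMeasurement s).toComplex.mulVec z l = z (s l) := by
  rw [Matrix.mulVec, dotProduct, Finset.sum_eq_single (s l)]
  · simp [unitMeasurement]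
  · intro v _ hv
    simp [unitMeasurement, hv]
  · simp

/-- The erased matrix passes the test but may have too many zeros; a generic point of the line to
`A` repairs the pattern and stays observable. -/
theorem structurallyObservable_of_reaches {n : ℕ} {A : Matrix (Fin n) (Fin n) ℝ}
    {M : Finset (Fin n × Fin n)} (hM : (systemDigraph A).IsLinkMatching M) {ι : Type*} [Fintype ι]
    (r : ι → Fin n) (hr : ∀ v ∈ unmatched M, ∃ l, r l = v)
    (hreach : ∀ v, ∃ l, (systemDigraph A).Reaches v (r l)) : StructurallyObservable A r := by
  obtain ⟨B, h1, h2, -⟩ := exists_matrix_of_matching hM r hreach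
  have hobs : Observable (eraseColumns (unmatched M) B) (unitMeasurement r) := by
    refine observable_of_eigenvector fun lam z hz hz0 => ?_
    have hzr : ∀ l, z (r l) = 0 := fun l =>
      (unitMeasurement_mulVec r z l).symm.trans (congrFun hz0 l)
    rw [eraseColumns_mulVec] at hz
    · exact h2 lam z hz hzr
    · intro u hu
      obtain ⟨l, rfl⟩ := hr u hu
      exact hzr l
  obtain ⟨t, ht, ht'⟩ := ((eventually_sameStructure h1).and
    (hobs.finite_not_line (A - eraseColumns (unmatched M) B)).compl_mem_cofinite).exists
  exact ⟨_, _, ht, measuresStates_unitMeasurement r, not_not.1 ht'⟩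

/-! ### Necessity of measuring every parent SCC. -/

/-- The powers of a matrix preserve the vectors supported on a set closed under outgoing links. -/
theorem pow_mulVec_eq_zero {V : Type*} [Fintype V] [DecidableEq V] {A : Matrix V V ℝ} {D : Set V}
    (hD : ∀ u ∈ D, ∀ v ∉ D, A v u = 0) {x : V → ℝ} (hx : ∀ v ∉ D, x v = 0) (k : ℕ) :
    ∀ v ∉ D, (A ^ k).mulVec x v = 0 := by
  induction k with
  | zero => simpa using hx
  | succ k ih =>
    intro v hv
    rw [pow_succ', ← Matrix.mulVec_mulVec, Matrix.mulVec, dotProduct]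
    refine Finset.sum_eq_zero fun u _ => ?_
    by_cases hu : u ∈ D
    · rw [hD u hu v hv, zero_mul]
    · rw [ih u hu, mul_zero]

/-- A nonempty set closed under outgoing links must be measured. -/
theorem not_observable_of_closed {V κ : Type*} [Fintype V] [DecidableEq V] {A : Matrix V V ℝ}
    {C : Matrix κ V ℝ} {D : Set V} (hne : D.Nonempty) (hD : ∀ u ∈ D, ∀ v ∉ D, A v u = 0)
    (hC : ∀ l, ∀ v ∈ D, C l v = 0) : ¬ Observable A C := by
  obtain ⟨d, hd⟩ := hne
  intro h
  have h0 := h (Pi.single d 1) fun k => by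
    ext l
    rw [Matrix.mulVec, dotProduct]
    refine Finset.sum_eq_zero fun v _ => ?_
    by_cases hv : v ∈ D
    · rw [hC l v hv, zero_mul]
    · rw [pow_mulVec_eq_zero hD _ k v hv, mul_zero]
      intro w hw
      exact Pi.single_eq_of_ne (fun h => hw (by rwa [h])) _
  have := congrFun h0 d
  simp at this

theorem StructurallyObservable.exists_mem_parentSCC {n : ℕ} {A : Matrix (Fin n) (Fin n) ℝ}
    {ι : Type*} {r : ι → Fin n} (h : StructurallyObservable A r) {D : Set (Fin n)}
    (hD : (systemDigraph A).IsParentSCC D) : ∃ l, r l ∈ D := by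
  obtain ⟨A', H, hA, hH, hobs⟩ := h
  by_contra! hr
  refine not_observable_of_closed hD.1.1 (fun u hu v hv => ?_) (fun l v hv => ?_) hobs
  · by_contra hne
    exact hD.2 u hu v hv ((hA v u).1 hne)
  · by_contra hne
    exact hr l ((hH l v).1 hne ▸ hv)

theorem fusedMeasurement_apply {n : ℕ} {ι : Type*} [DecidableEq ι] (H : Matrix ι (Fin n) ℝ)
    (N : ι → Finset ι) (i j : ι) (v u : Fin n) :
    fusedMeasurement H N (i, v) (j, u) = if i = j then ∑ l ∈ N i, H l v * H l u else 0 := by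
  simp [fusedMeasurement, Matrix.blockDiagonal_apply, Matrix.sum_apply, Matrix.vecMulVec_apply]

theorem DistributedObservable.exists_mem_parentSCC {n : ℕ} {A : Matrix (Fin n) (Fin n) ℝ}
    {ι : Type*} [Fintype ι] [DecidableEq ι] [Nonempty ι] {r : ι → Fin n} {Gβ : Digraph ι}
    {N : ι → Finset ι} (h : DistributedObservable A r Gβ N) {D : Set (Fin n)}
    (hD : (systemDigraph A).IsParentSCC D) : ∃ l, r l ∈ D := by
  obtain ⟨A', H, W, hA, hH, -, -, hobs⟩ := h
  by_contra! hr
  obtain ⟨d, hd⟩ := hD.1.1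
  inhabit ι
  refine not_observable_of_closed (D := {p : ι × Fin n | p.2 ∈ D}) ⟨(default, d), hd⟩
    (fun u hu v hv => ?_) (fun l v hv => ?_) hobs
  · have : A' v.2 u.2 = 0 := by
      by_contra hne
      exact hD.2 _ hu _ hv ((hA _ _).1 hne)
    rw [Matrix.kroneckerMap_apply, this, mul_zero]
  · rw [← Prod.mk.eta (p := l), ← Prod.mk.eta (p := v), fusedMeasurement_apply]
    have : ∀ j, H j v.2 = 0 := by
      intro j
      by_contra hne
      exact hr j ((hH j _).1 hne ▸ hv)
    simp [this]

/-! ### Positive eigenvectors of irreducible nonnegative matrices -/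

theorem mulVec_pos_of_pos {ι : Type*} [Fintype ι] {T : Matrix ι ι ℝ} (hT : ∀ i j, 0 < T i j) {x : ι → ℝ}
    (hx : ∀ i, 0 ≤ x i) (hne : x ≠ 0) (i : ι) : 0 < T.mulVec x i := by
  obtain ⟨j, hj⟩ := Function.ne_iff.1 hne
  exact Finset.sum_pos' (fun l _ => mul_nonneg (hT i l).le (hx l))
    ⟨j, Finset.mem_univ j, mul_pos (hT i j) ((hx j).lt_of_ne' hj)⟩

section Perron

variable {ι : Type*} [Fintype ι] [DecidableEq ι] {P : Matrix ι ι ℝ}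

theorem pow_nonneg_apply (hP : ∀ i j, 0 ≤ P i j) (k : ℕ) (i j : ι) : 0 ≤ (P ^ k) i j := by
  induction k generalizing i j with
  | zero =>
    rw [pow_zero, Matrix.one_apply]
    split_ifs <;> norm_num
  | succ k ih =>
    rw [pow_succ, Matrix.mul_apply]
    exact Finset.sum_nonneg fun l _ => mul_nonneg (ih i l) (hP l j)

/-- A positive diagonal keeps an entry positive in all higher powers, so the sum of the exponents
that work for the single entries works for all of them. -/
theorem exists_pow_pos (hP : ∀ i j, 0 ≤ P i j) (hd : ∀ i, 0 < P i i)
    (hreach : ∀ i j, Relation.ReflTransGen (fun a b => 0 < P b a) j i) :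
    ∃ N : ℕ, ∀ i j, 0 < (P ^ N) i j := by
  have hmono : ∀ i j k, 0 < (P ^ k) i j → 0 < (P ^ (k + 1)) i j := by
    intro i j k h
    rw [pow_succ, Matrix.mul_apply]
    exact (mul_pos h (hd j)).trans_le (Finset.single_le_sum (f := fun l => (P ^ k) i l * P l j)
      (fun l _ => mul_nonneg (pow_nonneg_apply hP k i l) (hP l j)) (Finset.mem_univ j))
  have hmono' : ∀ i j k l, k ≤ l → 0 < (P ^ k) i j → 0 < (P ^ l) i j := by
    intro i j k l hkl h
    induction hkl with
    | refl => exact h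
    | step _ ih => exact hmono _ _ _ ih
  have hex : ∀ i j, ∃ k : ℕ, 0 < (P ^ k) i j := by
    intro i j
    induction hreach i j with
    | refl => exact ⟨0, by simp⟩
    | @tail b c _ hbc ih =>
      obtain ⟨k, hk⟩ := ih
      refine ⟨k + 1, ?_⟩
      rw [pow_succ', Matrix.mul_apply]
      exact (mul_pos hbc hk).trans_le (Finset.single_le_sum (f := fun l => P c l * (P ^ k) l j)
        (fun l _ => mul_nonneg (hP c l) (pow_nonneg_apply hP k l j)) (Finset.mem_univ b))
  choose k hk using hex
  exact ⟨∑ i, ∑ j, k i j, fun i j => hmono' i j (k i j) _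
    ((Finset.single_le_sum (f := fun j => k i j) (fun _ _ => Nat.zero_le _)
      (Finset.mem_univ j)).trans (Finset.single_le_sum (f := fun i => ∑ j, k i j)
        (fun _ _ => Nat.zero_le _) (Finset.mem_univ i))) (hk i j)⟩

/-- The Perron vector, as a maximizer of the Collatz–Wielandt quotient. -/
theorem exists_pos_eigenvector [Nonempty ι] (hP : ∀ i j, 0 ≤ P i j) (hd : ∀ i, 0 < P i i)
    (hreach : ∀ i j, Relation.ReflTransGen (fun a b => 0 < P b a) j i) :
    ∃ (rho : ℝ) (d : ι → ℝ), 0 < rho ∧ (∀ i, 0 < d i) ∧ P.mulVec d = rho • d := by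
  obtain ⟨N, hN⟩ := exists_pow_pos hP hd hreach
  set T := P ^ N with hT
  have hpos : ∀ x ∈ stdSimplex ℝ ι, ∀ i, 0 < T.mulVec x i := by
    intro x hx i
    refine mulVec_pos_of_pos hN hx.1 (fun h0 => ?_) i
    have := hx.2
    simp [h0] at this
  -- The quotient is taken at `T x` instead of `x`: its denominators are positive on the whole
  -- simplex, boundary included, so it is continuous on a compact set.
  let f : (ι → ℝ) → ℝ := fun x =>
    Finset.univ.inf' Finset.univ_nonempty fun i => P.mulVec (T.mulVec x) i / T.mulVec x i
  have hf : ContinuousOn f (stdSimplex ℝ ι) := by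
    refine ContinuousOn.finset_inf'_apply _ fun i _ => ContinuousOn.div ?_ ?_ fun x hx =>
      (hpos x hx i).ne'
    · simp only [Matrix.mulVec_mulVec]
      exact ((continuous_apply i).comp (Continuous.matrix_mulVec continuous_const
        continuous_id)).continuousOn
    · exact ((continuous_apply i).comp (Continuous.matrix_mulVec continuous_const
        continuous_id)).continuousOn
  obtain ⟨i₀⟩ := ‹Nonempty ι›
  obtain ⟨x, hx, hmax⟩ := (isCompact_stdSimplex ℝ ι).exists_isMaxOn
    ⟨_, single_mem_stdSimplex ℝ i₀⟩ hf
  set y := T.mulVec x with hy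
  have hy0 : ∀ i, 0 < y i := hpos x hx
  have hle : ∀ i, f x * y i ≤ P.mulVec y i := fun i =>
    (le_div_iff₀ (hy0 i)).1 (Finset.inf'_le (fun i => P.mulVec (T.mulVec x) i / T.mulVec x i)
      (Finset.mem_univ i))
  have heq : P.mulVec y = f x • y := by
    by_contra hne
    -- If the nonnegative defect is nonzero, `T` makes it positive everywhere. Since `T` commutes
    -- with `P`, the normalized `y` would have a larger quotient than the maximizer.
    have hz := mulVec_pos_of_pos hN (x := P.mulVec y - f x • y)
      (fun i => by simpa using hle i) (sub_ne_zero.2 hne)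
    let c := ∑ i, y i
    have hc : 0 < c := Finset.sum_pos (fun i _ => hy0 i) ⟨i₀, Finset.mem_univ _⟩
    have hx' : c⁻¹ • y ∈ stdSimplex ℝ ι := by
      refine ⟨fun i => mul_nonneg (inv_nonneg.2 hc.le) (hy0 i).le, ?_⟩
      simp only [Pi.smul_apply, smul_eq_mul, ← Finset.mul_sum]
      exact inv_mul_cancel₀ hc.ne'
    have hlt : f x < f (c⁻¹ • y) := by
      refine (Finset.lt_inf'_iff _).2 fun i _ => ?_
      rw [lt_div_iff₀ (hpos _ hx' i)]
      have h1 := hz i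
      rw [Matrix.mulVec_sub, Matrix.mulVec_mulVec, hT, (Commute.pow_self P N).eq, ← hT,
        ← Matrix.mulVec_mulVec, Matrix.mulVec_smul, Pi.sub_apply, Pi.smul_apply, smul_eq_mul,
        sub_pos] at h1
      rw [Matrix.mulVec_smul, Matrix.mulVec_smul, Pi.smul_apply, Pi.smul_apply, smul_eq_mul,
        smul_eq_mul, mul_left_comm]
      exact mul_lt_mul_of_pos_left h1 (inv_pos.2 hc)
    exact absurd (hmax hx') (not_le.2 hlt)
  refine ⟨f x, y, ?_, hy0, heq⟩
  have h1 := congrFun heq i₀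
  have h2 : 0 < P.mulVec y i₀ := (mul_pos (hd i₀) (hy0 i₀)).trans_le
    (Finset.single_le_sum (f := fun l => P i₀ l * y l)
      (fun l _ => mul_nonneg (hP i₀ l) (hy0 l).le) (Finset.mem_univ i₀))
  rw [h1, Pi.smul_apply, smul_eq_mul] at h2
  exact pos_of_mul_pos_left h2 (hy0 i₀).le

end Perron

/-! ### The prediction-fusion weights -/

/-- Complex eigenvectors of an observable pair are measured. -/
theorem Observable.eigenvector_eq_zero {ι : Type*} [Fintype ι] [DecidableEq ι]
    {κ : Type*} {A : Matrix ι ι ℝ} {s : κ → ι} (h : Observable A (unitMeasurement s))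
    {lam : ℂ} {z : ι → ℂ} (hz : A.toComplex.mulVec z = lam • z) (h0 : ∀ l, z (s l) = 0) :
    z = 0 := by
  have hpow : ∀ k : ℕ, (A ^ k).toComplex.mulVec z = lam ^ k • z := by
    intro k
    induction k with
    | zero =>
      have : (A ^ 0).toComplex = 1 := by
        rw [pow_zero]
        exact map_one (Complex.ofRealHom.mapMatrix (m := ι))
      rw [this, Matrix.one_mulVec, pow_zero, one_smul]
    | succ k ih =>
      have : (A ^ (k + 1)).toComplex = A.toComplex * (A ^ k).toComplex := by
        rw [pow_succ']
        exact map_mul (Complex.ofRealHom.mapMatrix (m := ι)) A (A ^ k)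
      rw [this, ← Matrix.mulVec_mulVec, ih, Matrix.mulVec_smul, hz, smul_smul, pow_succ]
  have hre : ∀ (B : Matrix ι ι ℝ) (v : ι), (B.toComplex.mulVec z v).re =
      B.mulVec (fun i => (z i).re) v := by
    intro B v
    simp [Matrix.mulVec, dotProduct]
  have him : ∀ (B : Matrix ι ι ℝ) (v : ι), (B.toComplex.mulVec z v).im =
      B.mulVec (fun i => (z i).im) v := by
    intro B v
    simp [Matrix.mulVec, dotProduct]
  have hC : ∀ (y : ι → ℝ) l, (unitMeasurement s).mulVec y l = y (s l) := by
    intro y l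
    have := congrFun (Matrix.toComplex_mulVec (unitMeasurement s) y) l
    rw [unitMeasurement_mulVec] at this
    exact_mod_cast this.symm
  -- The real and imaginary parts of `z` have zero output at all times, as those of `lam ^ k • z`
  -- vanish at the measured nodes.
  have h1 := h (fun i => (z i).re) fun k => by
    ext l
    rw [hC, ← hre, hpow, Pi.smul_apply, h0]
    simp
  have h2 := h (fun i => (z i).im) fun k => by
    ext l
    rw [hC, ← him, hpow, Pi.smul_apply, h0]
    simp
  ext i
  exact Complex.ext (congrFun h1 i) (congrFun h2 i)

open Filter Topology in
-- Induction on `S`: move from `P` a short way towards a matrix observable from the new node. Small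
-- steps keep the entries on links positive, and each observability requirement excludes only
-- finitely many steps.
theorem exists_observable_from_each {ι : Type*} [Fintype ι] [DecidableEq ι] (G : Digraph ι)
    (hG : G.StronglyConnected) (hloop : ∀ i, G.Adj i i) (S : Finset ι) :
    ∃ P : Matrix ι ι ℝ, (∀ i j, G.Adj j i → 0 < P i j) ∧ (∀ i j, ¬ G.Adj j i → P i j = 0) ∧
      ∀ i ∈ S, Observable P (unitMeasurement fun _ : Unit => i) := by
  classical
  induction S using Finset.induction_on with
  | empty => exact ⟨fun i j => if G.Adj j i then 1 else 0, by simp +contextual, by simp, by simp⟩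
  | insert i S _ ih =>
    obtain ⟨P, hpos, hzero, hobs⟩ := ih
    -- The cycles of the identity are the self-loops, which the network has.
    obtain ⟨P', h1, h2, -⟩ := exists_matrix_of_perm G.Adj 1 {i} fun v => ⟨i, rfl, hG v i⟩
    have hobs' : Observable P' (unitMeasurement fun _ : Unit => i) :=
      observable_of_eigenvector fun lam z hz hz0 => h2 lam z hz (by
        rintro _ rfl
        exact (unitMeasurement_mulVec _ z ()).symm.trans (congrFun hz0 ()))
    have hpos' : ∀ᶠ t : ℝ in 𝓝[≠] 0, ∀ a b, G.Adj b a → 0 < (P + t • (P' - P)) a b := by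
      refine Filter.Eventually.filter_mono nhdsWithin_le_nhds ?_
      simp only [eventually_all]
      intro a b hab
      have hc : Continuous fun t : ℝ => P a b + t * (P' a b - P a b) := by fun_prop
      have := hc.continuousAt.eventually (lt_mem_nhds (a := 0) (b := P a b + 0 * (P' a b - P a b))
        (by simpa using hpos a b hab))
      simpa using this
    have hS : ∀ᶠ t : ℝ in 𝓝[≠] 0, ∀ j ∈ S,
        Observable (P + t • (P' - P)) (unitMeasurement fun _ : Unit => j) := by
      refine Filter.Eventually.filter_mono (nhdsNE_le_cofinite 0) ?_
      rw [Finset.eventually_all]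
      intro j hj
      filter_upwards [((hobs j hj).finite_not_line (P' - P)).compl_mem_cofinite] with t ht
      exact not_not.1 ht
    have hi : ∀ᶠ t : ℝ in 𝓝[≠] 0,
        Observable (P + t • (P' - P)) (unitMeasurement fun _ : Unit => i) := by
      refine Filter.Eventually.filter_mono (nhdsNE_le_cofinite 0) ?_
      have hfin := (hobs'.finite_not_line (P - P')).preimage
        (f := fun t : ℝ => 1 - t) (fun a _ b _ h => by simpa using h)
      filter_upwards [hfin.compl_mem_cofinite] with t ht
      have := not_not.1 ht
      rwa [show P' + (1 - t) • (P - P') = P + t • (P' - P) by module] at this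
    obtain ⟨t, ht, htS, hti⟩ := (hpos'.and (hS.and hi)).exists
    refine ⟨P + t • (P' - P), fun a b hab => ht a b hab, fun a b hab => ?_, fun j hj => ?_⟩
    · have : P' a b = 0 := by
        by_contra hne
        rcases h1 b a hne with h | h
        · exact hab h
        · rw [h] at hab
          exact hab (hloop b)
      simp [hzero a b hab, this]
    · rcases Finset.mem_insert.1 hj with rfl | hj
      · exact hti
      · exact htS j hj

/-- Conjugation by the Perron vector `d` and division by its eigenvalue make the rows sum to one.
The zero pattern is unchanged, and eigenvectors are only rescaled entrywise, so zero entries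
correspond. -/
theorem exists_rowStochastic {ι : Type*} [Fintype ι] [DecidableEq ι] [Nonempty ι] (G : Digraph ι)
    (hG : G.StronglyConnected) (hloop : ∀ i, G.Adj i i) :
    ∃ W ∈ Matrix.rowStochastic ℝ ι, (∀ i j, W i j ≠ 0 ↔ G.Adj j i) ∧
      ∀ (w : ℂ) (z : ι → ℂ) (i : ι), W.toComplex.mulVec z = w • z → z i = 0 → z = 0 := by
  classical
  obtain ⟨P, hpos, hzero, hobs⟩ := exists_observable_from_each G hG hloop Finset.univ
  have hnn : ∀ i j, 0 ≤ P i j := fun i j => by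
    by_cases h : G.Adj j i
    · exact (hpos i j h).le
    · exact (hzero i j h).ge
  obtain ⟨rho, d, hrho, hd, heq⟩ := exists_pos_eigenvector hnn (fun i => hpos i i (hloop i))
    fun i j => Relation.ReflTransGen.mono (fun a b h => hpos b a h) _ _ (hG j i)
  refine ⟨Matrix.of fun i j => P i j * d j / (rho * d i), ?_, fun i j => ?_, fun w z i hz h0 => ?_⟩
  · rw [Matrix.mem_rowStochastic_iff_sum]
    refine ⟨fun i j => div_nonneg (mul_nonneg (hnn i j) (hd j).le) (mul_pos hrho (hd i)).le,
      fun i => ?_⟩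
    simp only [Matrix.of_apply]
    rw [← Finset.sum_div, div_eq_one_iff_eq (mul_pos hrho (hd i)).ne']
    exact congrFun heq i
  · rw [Matrix.of_apply, div_ne_zero_iff, mul_ne_zero_iff]
    constructor
    · rintro ⟨⟨h, -⟩, -⟩
      by_contra hn
      exact h (hzero i j hn)
    · exact fun h => ⟨⟨(hpos i j h).ne', (hd j).ne'⟩, (mul_pos hrho (hd i)).ne'⟩
  · have hdc : ∀ j, (d j : ℂ) ≠ 0 := fun j => by exact_mod_cast (hd j).ne'
    have hrc : (rho : ℂ) ≠ 0 := by exact_mod_cast hrho.ne'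
    have key := (hobs i (Finset.mem_univ i)).eigenvector_eq_zero (lam := rho * w)
      (z := fun j => d j * z j) (by
        ext l
        have h1 := congrFun hz l
        simp only [Matrix.mulVec, dotProduct, Matrix.map_apply, Matrix.of_apply, Pi.smul_apply,
          smul_eq_mul, Complex.ofReal_div, Complex.ofReal_mul] at h1 ⊢
        rw [show (rho * w * (d l * z l) : ℂ) = rho * d l * (w * z l) by ring, ← h1,
          Finset.mul_sum]
        refine Finset.sum_congr rfl fun j _ => ?_
        have := hdc l
        field_simp) (fun _ => by simp [h0])
    ext j
    have := congrFun key j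
    exact (mul_eq_zero.1 this).resolve_left (hdc j)

/-! ### Observability of Kronecker products -/

/-- If all eigenvectors of `S` in an invariant subspace share their eigenvalue, then `S` is scalar on
the elements that a polynomial with distinct roots annihilates. -/
theorem exists_eigenvalue_of_prod {E : Type*} [AddCommGroup E] [Module ℂ E] (S : Module.End ℂ E)
    (U : Submodule ℂ E) (hU : ∀ x ∈ U, S x ∈ U)
    (huniq : ∀ x ∈ U, x ≠ 0 → ∀ y ∈ U, y ≠ 0 → ∀ a b : ℂ, S x = a • x → S y = b • y → a = b)
    (R : Finset ℂ) : ∀ x ∈ U, Polynomial.aeval S (∏ a ∈ R, (Polynomial.X - Polynomial.C a)) x = 0 →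
      ∃ a : ℂ, S x = a • x := by
  have hfac : ∀ (a : ℂ) x, Polynomial.aeval S (Polynomial.X - Polynomial.C a) x = S x - a • x := by
    intro a x
    simp [Algebra.algebraMap_eq_smul_one]
  have hpoly : ∀ (R : Finset ℂ), ∀ x ∈ U,
      Polynomial.aeval S (∏ a ∈ R, (Polynomial.X - Polynomial.C a)) x ∈ U := by
    intro R
    induction R using Finset.induction_on with
    | empty => simp
    | insert a R ha ih =>
      intro x hx
      rw [Finset.prod_insert ha, map_mul, Module.End.mul_apply, hfac]
      exact U.sub_mem (hU _ (ih x hx)) (U.smul_mem a (ih x hx))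
  induction R using Finset.induction_on with
  | empty =>
    intro x _ h
    exact ⟨0, by simp [show x = 0 by simpa using h]⟩
  | insert a R ha ih =>
    intro x hx h
    by_cases hy : Polynomial.aeval S (∏ a ∈ R, (Polynomial.X - Polynomial.C a)) x = 0
    · exact ih x hx hy
    · have hSy : S (Polynomial.aeval S (∏ a ∈ R, (Polynomial.X - Polynomial.C a)) x) =
          a • Polynomial.aeval S (∏ a ∈ R, (Polynomial.X - Polynomial.C a)) x := by
        rw [Finset.prod_insert ha, map_mul, Module.End.mul_apply, hfac] at h
        exact sub_eq_zero.1 h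
      -- Since `U` already contains an eigenvector for `a`, the factors for all other values are
      -- injective on `U` and can be cancelled.
      have hinj : ∀ R' ⊆ R, ∀ z ∈ U,
          Polynomial.aeval S (∏ a ∈ R', (Polynomial.X - Polynomial.C a)) z = 0 → z = 0 := by
        intro R'
        induction R' using Finset.induction_on with
        | empty => simp
        | insert b R' hb ihb =>
          intro hsub z hz h0
          rw [Finset.insert_subset_iff] at hsub
          refine ihb hsub.2 z hz ?_
          by_contra hne
          rw [Finset.prod_insert hb, map_mul, Module.End.mul_apply, hfac, sub_eq_zero] at h0
          exact ha (huniq _ (hpoly R x hx) hy _ (hpoly R' z hz) hne a b hSy h0 ▸ hsub.1)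
      refine ⟨a, sub_eq_zero.1 (hinj R subset_rfl _ (U.sub_mem (hU x hx) (U.smul_mem a hx)) ?_)⟩
      rw [← hfac, ← Module.End.mul_apply, ← map_mul, mul_comm]
      rwa [Finset.prod_insert ha] at h

/-- `μ` is an eigenvalue of `A`. -/
def IsEigen {V : Type*} [Fintype V] (A : Matrix V V ℂ) (μ : ℂ) : Prop :=
  ∃ z : V → ℂ, z ≠ 0 ∧ A.mulVec z = μ • z

theorem finite_isEigen {V : Type*} [Fintype V] [DecidableEq V] (A : Matrix V V ℂ) :
    {μ | IsEigen A μ}.Finite := by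
  refine (Module.End.finite_hasEigenvalue (Matrix.toLin' A)).subset fun μ hμ => ?_
  obtain ⟨z, hz, h⟩ := hμ
  exact Module.End.hasEigenvalue_of_hasEigenvector
    (Module.End.hasEigenvector_iff.2 ⟨Module.End.mem_eigenspace_iff.2 (by simpa using h), hz⟩)

section Kronecker

variable {ι V : Type*} [Fintype V]

/-- `A` acting on every block. -/
def blockAction (ι : Type*) (A : Matrix V V ℂ) : Module.End ℂ (ι × V → ℂ) where
  toFun z p := A.mulVec (fun u => z (p.1, u)) p.2
  map_add' x y := by
    ext p
    exact congrFun (A.mulVec_add (fun u => x (p.1, u)) fun u => y (p.1, u)) p.2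
  map_smul' c x := by
    ext p
    exact congrFun (A.mulVec_smul c fun u => x (p.1, u)) p.2

theorem blockAction_aeval [DecidableEq V] (A : Matrix V V ℂ) (q : Polynomial ℂ) (z : ι × V → ℂ) (i : ι) :
    (fun v => Polynomial.aeval (blockAction ι A) q z (i, v)) =
      (Polynomial.aeval A q).mulVec fun v => z (i, v) := by
  induction q using Polynomial.induction_on' with
  | add p q hp hq =>
    rw [map_add, map_add, Matrix.add_mulVec, ← hp, ← hq]
    rfl
  | monomial k a =>
    have hpow : ∀ k : ℕ, (fun v => (blockAction ι A ^ k) z (i, v)) =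
        (A ^ k).mulVec fun v => z (i, v) := by
      intro k
      induction k with
      | zero => simp
      | succ k ih =>
        rw [pow_succ' A, ← Matrix.mulVec_mulVec, ← ih, pow_succ']
        rfl
    rw [Polynomial.aeval_monomial, Polynomial.aeval_monomial, Algebra.algebraMap_eq_smul_one,
      Algebra.algebraMap_eq_smul_one, smul_one_mul, smul_one_mul, Matrix.smul_mulVec, ← hpow]
    rfl

variable [Fintype ι]

theorem kronecker_mulVec_apply (W : Matrix ι ι ℂ) (A : Matrix V V ℂ) (z : ι × V → ℂ) (i : ι)
    (v : V) : (W ⊗ₖ A).mulVec z (i, v) = W.mulVec (fun j => blockAction ι A z (j, v)) i := by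
  simp only [Matrix.mulVec, dotProduct, Matrix.kroneckerMap_apply, Fintype.sum_prod_type,
    Finset.mul_sum, blockAction, LinearMap.coe_mk, AddHom.coe_mk, mul_assoc]

theorem blockAction_kronecker (W : Matrix ι ι ℂ) (A : Matrix V V ℂ) (z : ι × V → ℂ) :
    blockAction ι A ((W ⊗ₖ A).mulVec z) = (W ⊗ₖ A).mulVec (blockAction ι A z) := by
  ext ⟨i, v⟩
  rw [kronecker_mulVec_apply]
  simp only [blockAction, LinearMap.coe_mk, AddHom.coe_mk]
  have h : (fun u => (W ⊗ₖ A).mulVec z (i, u)) =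
      fun u => ∑ j, W i j * (A.mulVec fun u => z (j, u)) u := by
    ext u
    rw [kronecker_mulVec_apply]
    rfl
  rw [h]
  simp only [Matrix.mulVec, dotProduct, Finset.mul_sum]
  rw [Finset.sum_comm]
  refine Finset.sum_congr rfl fun j _ => Finset.sum_congr rfl fun u _ =>
    Finset.sum_congr rfl fun w _ => by ring

/-- The eigenvector test for the Kronecker product of a matrix `W` without eigenvectors that vanish
somewhere, and a diagonalizable matrix `A`. -/
theorem kronecker_eigenvector_eq_zero [DecidableEq ι] [DecidableEq V] {W : Matrix ι ι ℂ} {A : Matrix V V ℂ} {s : ι → V}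
    {R : Finset ℂ} (hW : ∀ z, W.mulVec z = 0 → z = 0) (hA : ∀ z, A.mulVec z = 0 → z = 0)
    (hWz : ∀ (w : ℂ) (z : ι → ℂ) (i : ι), W.mulVec z = w • z → z i = 0 → z = 0)
    (hAR : Polynomial.aeval A (∏ a ∈ R, (Polynomial.X - Polynomial.C a)) = 0)
    (hAs : ∀ (a : ℂ) (z : V → ℂ), A.mulVec z = a • z → (∀ i, z (s i) = 0) → z = 0)
    (hres : ∀ w w' a a', IsEigen W w → IsEigen W w' → IsEigen A a → IsEigen A a' →
      w * a = w' * a' → a = a')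
    {lam : ℂ} {z : ι × V → ℂ} (hz : (W ⊗ₖ A).mulVec z = lam • z) (hs : ∀ i, z (i, s i) = 0) :
    z = 0 := by
  by_contra hne
  obtain ⟨⟨i₀, v₀⟩, hz₀⟩ := Function.ne_iff.1 hne
  have hlam : lam ≠ 0 := by
    rintro rfl
    rw [zero_smul] at hz
    have h1 : ∀ v, (fun j => blockAction ι A z (j, v)) = 0 := fun v => hW _ (by
      ext i
      rw [← kronecker_mulVec_apply, hz]
      rfl)
    have h2 : (fun u => z (i₀, u)) = 0 := hA _ (by
      ext v
      exact congrFun (h1 v) i₀)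
    exact hz₀ (congrFun h2 v₀)
  let U : Submodule ℂ (ι × V → ℂ) := LinearMap.ker ((W ⊗ₖ A).mulVecLin - lam • LinearMap.id)
  have hU : ∀ x, x ∈ U ↔ (W ⊗ₖ A).mulVec x = lam • x := by
    intro x
    simp [U, sub_eq_zero]
  have hrow : ∀ (a : ℂ) (x : ι × V → ℂ), blockAction ι A x = a • x → ∀ i,
      A.mulVec (fun v => x (i, v)) = a • fun v => x (i, v) := by
    intro a x hx i
    ext v
    exact congrFun hx (i, v)
  have hcol : ∀ (a : ℂ) (x : ι × V → ℂ), x ∈ U → blockAction ι A x = a • x → a ≠ 0 → ∀ v,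
      W.mulVec (fun i => x (i, v)) = (lam / a) • fun i => x (i, v) := by
    intro a x hx hax ha v
    ext i
    have h1 := congrFun ((hU x).1 hx) (i, v)
    rw [kronecker_mulVec_apply, hax] at h1
    have h2 : W.mulVec (fun j => (a • x) (j, v)) i = a * W.mulVec (fun j => x (j, v)) i :=
      congrFun (W.mulVec_smul a fun j => x (j, v)) i
    rw [h2, Pi.smul_apply, smul_eq_mul] at h1
    rw [Pi.smul_apply, smul_eq_mul, div_mul_eq_mul_div, eq_div_iff ha, ← h1, mul_comm]
  have heig : ∀ (a : ℂ) (x : ι × V → ℂ), x ∈ U → x ≠ 0 → blockAction ι A x = a • x →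
      a ≠ 0 ∧ IsEigen A a ∧ IsEigen W (lam / a) := by
    intro a x hx hx0 hax
    obtain ⟨⟨i, v⟩, hiv⟩ := Function.ne_iff.1 hx0
    have hr : (fun v => x (i, v)) ≠ 0 := fun h => hiv (congrFun h v)
    have hc : (fun i => x (i, v)) ≠ 0 := fun h => hiv (congrFun h i)
    have ha : a ≠ 0 := by
      rintro rfl
      exact hr (hA _ (by rw [hrow 0 x hax i, zero_smul]))
    exact ⟨ha, ⟨_, hr, hrow a x hax i⟩, ⟨_, hc, hcol a x hx hax ha v⟩⟩
  -- The eigenspace `U` of `W ⊗ₖ A` is invariant under `A` acting blockwise. An eigenvalue `a` of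
  -- that action on `U` comes with the eigenvalue `lam / a` of `W`, so the absence of resonances
  -- leaves only one `a`, and `z` itself is an eigenvector.
  obtain ⟨a, ha⟩ := exists_eigenvalue_of_prod (blockAction ι A) U
    (fun x hx => by
      rw [hU] at hx ⊢
      rw [← blockAction_kronecker, hx, map_smul])
    (fun x hx hx0 y hy hy0 a b hax hby => by
      obtain ⟨ha0, ha1, ha2⟩ := heig a x hx hx0 hax
      obtain ⟨hb0, hb1, hb2⟩ := heig b y hy hy0 hby
      exact hres _ _ _ _ ha2 hb2 ha1 hb1 (by rw [div_mul_cancel₀ _ ha0, div_mul_cancel₀ _ hb0]))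
    R z ((hU z).2 hz) (by
      ext ⟨i, v⟩
      have := congrFun (blockAction_aeval A (∏ a ∈ R, (Polynomial.X - Polynomial.C a)) z i) v
      rw [hAR, Matrix.zero_mulVec] at this
      exact this)
  have ha0 := (heig a z ((hU z).2 hz) hne ha).1
  have hc := hcol a z ((hU z).2 hz) ha ha0
  have hnz : ∀ i, z (i, v₀) ≠ 0 := fun i h =>
    hz₀ (congrFun (hWz _ (fun i => z (i, v₀)) i (hc v₀) h) i₀)
  -- All columns of `z` are eigenvectors of `W` for the same value. A combination of two that
  -- vanishes at `i₀` is zero, so `z` has rank one.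
  have hprop : ∀ i v, z (i₀, v₀) * z (i, v) = z (i₀, v) * z (i, v₀) := by
    intro i v
    have := hWz (lam / a) (z (i₀, v₀) • (fun i => z (i, v)) - z (i₀, v) • fun i => z (i, v₀)) i₀
      (by rw [Matrix.mulVec_sub, Matrix.mulVec_smul, Matrix.mulVec_smul, hc, hc, smul_sub,
            smul_comm, smul_comm (z (i₀, v))]) (by simp [mul_comm])
    exact sub_eq_zero.1 (congrFun this i)
  have hzero : (fun v => z (i₀, v)) = 0 := hAs a _ (hrow a z ha i₀) fun i => by
    have := hprop i (s i)
    rw [hs, mul_zero] at this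
    exact (mul_eq_zero.1 this.symm).resolve_right (hnz i)
  exact hz₀ (congrFun hzero v₀)

end Kronecker

/-! ### Structural distributed observability -/

open Filter Topology in
/-- The spectrum of `(1 - ε) I + ε W` avoids resonances with a finite set, for almost all `ε`. -/
theorem eventually_not_resonant (S T : Set ℂ) (hS : S.Finite) (hT : T.Finite) :
    ∀ᶠ e : ℝ in cofinite, ∀ w ∈ S, ∀ w' ∈ S, ∀ a ∈ T, ∀ a' ∈ T,
      (1 - e + e * w) * a = (1 - e + e * w') * a' → a = a' := by
  simp only [hS.eventually_all, hT.eventually_all]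
  intro w _ w' _ a _ a' _
  by_cases haa : a = a'
  · exact Eventually.of_forall fun _ _ => haa
  · have hfin : {e : ℝ | ((1 - e + e * w) * a : ℂ) = (1 - e + e * w') * a'}.Finite := by
      refine Set.Subsingleton.finite fun e he e' he' => ?_
      replace he : ((1 - e + e * w) * a : ℂ) = (1 - e + e * w') * a' := he
      replace he' : ((1 - e' + e' * w) * a : ℂ) = (1 - e' + e' * w') * a' := he'
      -- The equation is affine in `e` with constant term `a - a'`; if its slope vanished, so would
      -- this term.
      have h0 : (w - 1) * a - (w' - 1) * a' ≠ 0 := by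
        intro h0
        apply haa
        linear_combination he - e * h0
      have h1 : ((e : ℂ) - e') * ((w - 1) * a - (w' - 1) * a') = 0 := by
        linear_combination he - he'
      have h2 := sub_eq_zero.1 ((mul_eq_zero.1 h1).resolve_right h0)
      exact_mod_cast h2
    filter_upwards [hfin.compl_mem_cofinite] with e he h
    exact absurd h he

theorem toComplex_kronecker {ι V : Type*} (W : Matrix ι ι ℝ) (A : Matrix V V ℝ) :
    (W ⊗ₖ A).toComplex = W.toComplex ⊗ₖ A.toComplex := by
  ext
  simp

theorem exists_finset_aeval_prod_eq_zero {V : Type*} [Fintype V] [DecidableEq V]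
    {B : Matrix V V ℝ} {p : Polynomial ℝ} (hp : p.Separable) (hpB : Polynomial.aeval B p = 0) :
    ∃ R : Finset ℂ, Polynomial.aeval B.toComplex (∏ a ∈ R, (Polynomial.X - Polynomial.C a)) = 0 := by
  classical
  set q := p.map (algebraMap ℝ ℂ) with hq
  have hsep : q.Separable := hp.map
  have hqB : Polynomial.aeval B.toComplex q = 0 := by
    rw [hq, Polynomial.aeval_map_algebraMap]
    have := Polynomial.aeval_algHom_apply (Complex.ofRealAm.mapMatrix (m := V)) B p
    rw [hpB, map_zero] at this
    exact this
  refine ⟨q.roots.toFinset, ?_⟩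
  have hprod : q = Polynomial.C q.leadingCoeff *
      ∏ a ∈ q.roots.toFinset, (Polynomial.X - Polynomial.C a) := by
    rw [Finset.prod_eq_multiset_prod, Multiset.toFinset_val,
      (Polynomial.nodup_roots hsep).dedup]
    exact (IsAlgClosed.splits q).eq_prod_roots
  rw [hprod, map_mul, Polynomial.aeval_C, ← Algebra.smul_def] at hqB
  exact (smul_eq_zero.1 hqB).resolve_left
    (Polynomial.leadingCoeff_ne_zero.2 hsep.ne_zero)

/-- Prediction-fusion weights for which the Kronecker product passes the eigenvector test. -/
theorem exists_rowStochastic_kronecker {ι V : Type*} [Fintype ι] [DecidableEq ι] [Nonempty ι]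
    [Fintype V] [DecidableEq V] (G : Digraph ι) (hG : G.StronglyConnected)
    (hloop : ∀ i, G.Adj i i) {B : Matrix V V ℝ} {s : ι → V}
    (hBs : ∀ (lam : ℂ) (z : V → ℂ), B.toComplex.mulVec z = lam • z → (∀ l, z (s l) = 0) → z = 0)
    (hB : ∀ z : V → ℂ, B.toComplex.mulVec z = 0 → z = 0) {p : Polynomial ℝ} (hp : p.Separable)
    (hpB : Polynomial.aeval B p = 0) :
    ∃ W ∈ Matrix.rowStochastic ℝ ι, (∀ i j, W i j ≠ 0 ↔ G.Adj j i) ∧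
      ∀ (lam : ℂ) (z : ι × V → ℂ), (W ⊗ₖ B).toComplex.mulVec z = lam • z →
        (∀ i, z (i, s i) = 0) → z = 0 := by
  classical
  obtain ⟨W, hW, hpat, hfull⟩ := exists_rowStochastic G hG hloop
  rw [Matrix.mem_rowStochastic_iff_sum] at hW
  obtain ⟨R, hR⟩ := exists_finset_aeval_prod_eq_zero hp hpB
  -- The values `0` and `1` are adjoined to exclude the eigenvalue `0` of the mixed matrix: it would
  -- make `1` and `0` resonant. The range `0 < e < 1` keeps the rows stochastic and the pattern
  -- intact, the diagonal being positive anyway.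
  obtain ⟨e, he, he0, he1⟩ := (((eventually_not_resonant {w | IsEigen W.toComplex w}
    ({a | IsEigen B.toComplex a} ∪ {0, 1}) (finite_isEigen _)
    ((finite_isEigen _).union (Set.toFinite _))).filter_mono
      ((nhdsGT_le_nhdsNE 0).trans (nhdsNE_le_cofinite 0))).and
    (Ioo_mem_nhdsGT (zero_lt_one' ℝ))).exists
  let W' : Matrix ι ι ℝ := (1 - e) • (1 : Matrix ι ι ℝ) + e • W
  have hW' : ∀ i j, W' i j = (if i = j then 1 - e else 0) + e * W i j := fun i j => by
    simp [W', Matrix.one_apply]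
  have hec : (e : ℂ) ≠ 0 := by exact_mod_cast he0.ne'
  have hmul : ∀ z, W'.toComplex.mulVec z = (1 - e : ℂ) • z + (e : ℂ) • W.toComplex.mulVec z := by
    intro z
    have : W'.toComplex = (1 - e : ℂ) • (1 : Matrix ι ι ℂ) + (e : ℂ) • W.toComplex := by
      ext i j
      rw [show W'.toComplex i j = ((W' i j : ℝ) : ℂ) from rfl, hW']
      by_cases h : i = j <;> simp [h]
    rw [this, Matrix.add_mulVec, Matrix.smul_mulVec, Matrix.smul_mulVec, Matrix.one_mulVec]
  have heig : ∀ (w : ℂ) z, W'.toComplex.mulVec z = w • z →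
      W.toComplex.mulVec z = ((w - (1 - e)) / e) • z := by
    intro w z h
    rw [hmul] at h
    have h1 : (e : ℂ) • W.toComplex.mulVec z = (w - (1 - e)) • z := by
      rw [sub_smul, ← h, add_sub_cancel_left]
    rw [div_eq_inv_mul, mul_smul, ← h1, smul_smul, inv_mul_cancel₀ hec, one_smul]
  have hback : ∀ w : ℂ, (1 - e + e * ((w - (1 - e)) / e) : ℂ) = w := by
    intro w
    field_simp
    ring
  refine ⟨W', ?_, fun i j => ?_, fun lam z hz hs => ?_⟩
  · rw [Matrix.mem_rowStochastic_iff_sum]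
    refine ⟨fun i j => ?_, fun i => ?_⟩
    · rw [hW']
      have := mul_nonneg he0.le (hW.1 i j)
      split_ifs <;> linarith
    · simp only [hW', Finset.sum_add_distrib, ← Finset.mul_sum, hW.2 i]
      simp
  · rw [hW']
    have h1 := hW.1 i j
    by_cases h : i = j
    · subst h
      rw [if_pos rfl]
      exact ⟨fun _ => hloop i, fun _ => ne_of_gt (by nlinarith)⟩
    · rw [if_neg h, zero_add, mul_ne_zero_iff, hpat]
      exact ⟨fun h => h.2, fun h => ⟨he0.ne', h⟩⟩
  · rw [toComplex_kronecker] at hz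
    refine kronecker_eigenvector_eq_zero (fun z hz0 => ?_) hB
      (fun w z i h => hfull _ z i (heig w z h)) hR hBs ?_ hz hs
    · by_contra hne
      have h1 := heig 0 z (by rw [hz0, zero_smul])
      have h2 := hback 0
      have := he _ ⟨z, hne, h1⟩ _ ⟨z, hne, h1⟩ 1 (by simp) 0 (by simp) (by rw [h2]; ring)
      exact one_ne_zero this
    · rintro w w' a a' ⟨z, hz, h⟩ ⟨z', hz', h'⟩ ha ha' heq
      exact he _ ⟨z, hz, heig w z h⟩ _ ⟨z', hz', heig w' z' h'⟩ a (Or.inl ha) a' (Or.inl ha')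
        (by rw [hback, hback, heq])

open Filter Topology in
-- Each sensor has access to all unmatched states through its neighbourhood, which restores the
-- erased columns block by block; its own measurement is all the eigenvector test needs beyond that.
theorem distributedObservable_of_reaches {n : ℕ} {A : Matrix (Fin n) (Fin n) ℝ}
    {M : Finset (Fin n × Fin n)} (hM : (systemDigraph A).IsLinkMatching M) {ι : Type*} [Fintype ι]
    [DecidableEq ι] [Nonempty ι] (s : ι → Fin n) (G : Digraph ι) (hG : G.StronglyConnected)
    (hloop : ∀ i, G.Adj i i) (N : ι → Finset ι) (hself : ∀ i, i ∈ N i)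
    (hN : ∀ i, ∀ v ∈ unmatched M, ∃ l ∈ N i, s l = v)
    (hreach : ∀ v, ∃ l, (systemDigraph A).Reaches v (s l)) : DistributedObservable A s G N := by
  obtain ⟨B, h1, h2, h3, p, hp, hpB⟩ := exists_matrix_of_matching hM s hreach
  obtain ⟨W, hW, hpat, hWz⟩ := exists_rowStochastic_kronecker G hG hloop h2 h3 hp hpB
  set B' := eraseColumns (unmatched M) B with hB'
  have hobs : Observable (W ⊗ₖ B') (fusedMeasurement (unitMeasurement s) N) := by
    refine observable_of_eigenvector fun lam z hz hz0 => ?_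
    have hzs : ∀ i, ∀ l ∈ N i, z (i, s l) = 0 := by
      intro i l hl
      -- With unit measurements the blocks of `D_H` are diagonal, and the entry at a state measured
      -- in the neighbourhood is positive.
      have h0 := congrFun hz0 (i, s l)
      simp only [Matrix.mulVec, dotProduct, Fintype.sum_prod_type, Matrix.map_apply,
        fusedMeasurement_apply] at h0
      rw [Finset.sum_eq_single i (fun j _ hj => by simp [hj.symm]) (by simp),
        Finset.sum_eq_single (s l)] at h0
      · refine (mul_eq_zero.1 h0).resolve_left ?_
        rw [if_pos rfl]
        have : 0 < ∑ j ∈ N i, unitMeasurement s j (s l) * unitMeasurement s j (s l) :=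
          Finset.sum_pos' (fun j _ => mul_self_nonneg _) ⟨l, hl, by simp [unitMeasurement]⟩
        exact_mod_cast this.ne'
      · intro v _ hv
        rw [if_pos rfl, Finset.sum_eq_zero, Complex.ofReal_zero, zero_mul]
        intro j _
        by_cases hj : s l = s j
        · simp [unitMeasurement, ← hj, hv]
        · simp [unitMeasurement, hj]
      · simp
    refine hWz lam z ?_ fun i => hzs i i (hself i)
    rw [← hz, toComplex_kronecker, toComplex_kronecker]
    ext ⟨i, v⟩
    rw [kronecker_mulVec_apply, kronecker_mulVec_apply]
    congr 1
    ext j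
    refine (congrFun (eraseColumns_mulVec (unmatched M) B (fun u => z (j, u)) fun u hu => ?_) v).symm
    obtain ⟨l, hl, rfl⟩ := hN j u hu
    exact hzs j l hl
  -- `W` stays fixed while the system matrix moves, so the Kronecker products also run along a line.
  obtain ⟨t, ht, ht'⟩ := ((eventually_sameStructure h1).and
    (hobs.finite_not_line (W ⊗ₖ (A - B'))).compl_mem_cofinite).exists
  refine ⟨_, _, W, ht, measuresStates_unitMeasurement s, hW, hpat, ?_⟩
  rw [Matrix.kronecker_add, Matrix.kronecker_smul]
  exact not_not.1 ht'

/-! ### Strongly connected components -/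

namespace Digraph

variable {V : Type*} {G : Digraph V}

theorem IsSCC.eq_of_mem {C D : Set V} (hC : G.IsSCC C) (hD : G.IsSCC D) {u : V} (huC : u ∈ C)
    (huD : u ∈ D) : C = D := by
  ext v
  rw [hC.2 u huC v, hD.2 u huD v]

theorem isSCC_setOf (u : V) : G.IsSCC {v | G.Reaches u v ∧ G.Reaches v u} :=
  ⟨⟨u, .refl, .refl⟩, fun _ hv _ => ⟨fun hw => ⟨hv.2.trans hw.1, hw.2.trans hv.1⟩,
    fun hw => ⟨hv.1.trans hw.1, hw.2.trans hv.2⟩⟩⟩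

theorem exists_isSCC_iff {u v : V} :
    (∃ C, G.IsSCC C ∧ u ∈ C ∧ v ∈ C) ↔ G.Reaches u v ∧ G.Reaches v u :=
  ⟨fun ⟨_, hC, hu, hv⟩ => (hC.2 u hu v).1 hv,
    fun h => ⟨_, isSCC_setOf u, ⟨.refl, .refl⟩, h⟩⟩

theorem IsSCC.mem_equivalentStates_iff {C : Set V} (hC : G.IsSCC C) {i : V} (hi : i ∈ C) {j : V} :
    j ∈ G.equivalentStates i ↔ j ≠ i ∧ j ∈ C := by
  refine and_congr_right fun _ => ⟨?_, fun h => ⟨C, hC, hi, h⟩⟩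
  rintro ⟨D, hD, hiD, hjD⟩
  rwa [hC.eq_of_mem hD hi hiD]

end Digraph

theorem structurallyObservable_iff {n : ℕ} {A : Matrix (Fin n) (Fin n) ℝ}
    {M : Finset (Fin n × Fin n)} (hM : (systemDigraph A).IsLinkMatching M) {ι : Type*} [Fintype ι]
    (r : ι → Fin n) (hr : ∀ v ∈ unmatched M, ∃ l, r l = v) :
    StructurallyObservable A r ↔ ∀ D, (systemDigraph A).IsParentSCC D → ∃ l, r l ∈ D := by
  refine ⟨fun h D hD => h.exists_mem_parentSCC hD, fun h =>
    structurallyObservable_of_reaches hM r hr fun v => ?_⟩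
  obtain ⟨_, ⟨l, rfl⟩, hl⟩ := (systemDigraph A).exists_reaches_of_parentSCC (fun y => ∃ l, r l = y)
    (fun D hD => let ⟨l, hl⟩ := h D hD; ⟨_, hl, l, rfl⟩) v
  exact ⟨l, hl⟩

/-- Sensor `k` is not a hub, so all unmatched states remain measured by hubs. The only parent SCC
that it measures is `C`, which the new sensor measures too. -/
theorem sensor_recovery {n m : ℕ} {A : Matrix (Fin n) (Fin n) ℝ} {s : Fin m → Fin n}
    {M : Finset (Fin n × Fin n)} {G : Digraph (Fin m)} {k : Fin m} {C : Set (Fin n)}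
    (hM : (systemDigraph A).IsLinkMatching M) (hs : ∀ v ∈ unmatched M, ∃ l, s l = v)
    (hobs : StructurallyObservable A s) (hG : G.StronglyConnected) (hloop : ∀ l, G.Adj l l)
    (hC : (systemDigraph A).IsParentSCC C) (hk : s k ∈ C) (hkM : s k ∉ unmatched M) {j : Fin n}
    (hj : j ∈ C) :
    StructurallyObservable A (Function.update s k j) ∧
      DistributedObservable A (Function.update s k j) G
        (hubNeighborhood (Finset.univ.filter fun l => s l ∈ unmatched M)) := by
  have hhub : ∀ v ∈ unmatched M, ∃ l, s l ∈ unmatched M ∧ Function.update s k j l = v := by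
    intro v hv
    obtain ⟨l, rfl⟩ := hs v hv
    have hlk : l ≠ k := by
      rintro rfl
      exact hkM hv
    exact ⟨l, hv, Function.update_of_ne hlk _ _⟩
  have hobs' : StructurallyObservable A (Function.update s k j) := by
    refine (structurallyObservable_iff hM _ fun v hv => let ⟨l, _, hl⟩ := hhub v hv; ⟨l, hl⟩).2
      fun D hD => ?_
    obtain ⟨l, hl⟩ := hobs.exists_mem_parentSCC hD
    by_cases hlk : l = k
    · subst hlk
      refine ⟨l, ?_⟩
      rw [Function.update_self, hD.1.eq_of_mem hC.1 hl hk]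
      exact hj
    · exact ⟨l, by rwa [Function.update_of_ne hlk]⟩
  refine ⟨hobs', ?_⟩
  have : Nonempty (Fin m) := ⟨k⟩
  refine distributedObservable_of_reaches hM _ G hG hloop _ (fun i => Finset.mem_insert_self _ _)
    (fun i v hv => ?_) fun v => ?_
  · obtain ⟨l, hl, hlv⟩ := hhub v hv
    exact ⟨l, Finset.mem_insert_of_mem (by simpa using hl), hlv⟩
  · obtain ⟨_, ⟨l, rfl⟩, hl⟩ := (systemDigraph A).exists_reaches_of_parentSCC
      (fun y => ∃ l, Function.update s k j l = y)
      (fun D hD => let ⟨l, hl⟩ := hobs'.exists_mem_parentSCC hD; ⟨_, hl, l, rfl⟩) v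
    exact ⟨l, hl⟩

theorem sensor_failure {n m : ℕ} {A : Matrix (Fin n) (Fin n) ℝ} {s : Fin m → Fin n}
    {G : Digraph (Fin m)} {k : Fin m} {C : Set (Fin n)} (N : Fin m → Finset (Fin m))
    (hC : (systemDigraph A).IsParentSCC C) (h : ∀ l, l ≠ k → s l ∉ C) :
    ¬ StructurallyObservable A (fun l : {l : Fin m // l ≠ k} => s l) ∧
      ∀ j ∉ C, ¬ StructurallyObservable A (Function.update s k j) ∧
        ¬ DistributedObservable A (Function.update s k j) G N := by
  have hupd : ∀ j ∉ C, ¬ ∃ l, Function.update s k j l ∈ C := by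
    rintro j hj ⟨l, hl⟩
    by_cases hlk : l = k
    · subst hlk
      rw [Function.update_self] at hl
      exact hj hl
    · rw [Function.update_of_ne hlk] at hl
      exact h l hlk hl
  have : Nonempty (Fin m) := ⟨k⟩
  refine ⟨fun hobs => ?_, fun j hj => ⟨fun hobs => hupd j hj (hobs.exists_mem_parentSCC hC),
    fun hobs => hupd j hj (hobs.exists_mem_parentSCC hC)⟩⟩
  obtain ⟨l, hl⟩ := hobs.exists_mem_parentSCC hC
  exact h l l.2 hl

/-! ### Running programs -/

/-- `p` halts, started in `σ`, within `T` steps in a state that satisfies `Q`. -/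
def Runs (p : RamProgram) (σ : RamState) (T : ℕ) (Q : RamState → Prop) : Prop :=
  ∃ τ t, RamExec p σ τ t ∧ t ≤ T ∧ Q τ

namespace RamProgram

/-- The programs without loops. -/
def LoopFree : RamProgram → Prop
  | seq p q => p.LoopFree ∧ q.LoopFree
  | branch _ p q => p.LoopFree ∧ q.LoopFree
  | loop _ _ => False
  | _ => True

/-- The effect of a program without loops. -/
def eval : RamProgram → RamState → RamState
  | const x c, σ => σ.setReg x c
  | add x y z, σ => σ.setReg x (σ.reg y + σ.reg z)
  | sub x y z, σ => σ.setReg x (σ.reg y - σ.reg z)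
  | load x y, σ => σ.setReg x (σ.mem (σ.reg y))
  | store x y, σ => σ.setMem (σ.reg x) (σ.reg y)
  | seq p q, σ => q.eval (p.eval σ)
  | branch x p q, σ => if σ.reg x = 0 then q.eval σ else p.eval σ
  | loop _ _, σ => σ

/-- A bound for the running time of a program without loops. -/
def size : RamProgram → ℕ
  | seq p q => p.size + q.size
  | branch _ p q => p.size + q.size + 1
  | _ => 1

end RamProgram

theorem Runs.mono {p : RamProgram} {σ : RamState} {T T' : ℕ} {Q Q' : RamState → Prop}
    (h : Runs p σ T Q) (hT : T ≤ T') (hQ : ∀ τ, Q τ → Q' τ) : Runs p σ T' Q' := by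
  obtain ⟨τ, t, he, ht, hq⟩ := h
  exact ⟨τ, t, he, ht.trans hT, hQ τ hq⟩

theorem Runs.seq {p q : RamProgram} {σ : RamState} {T U : ℕ} {Q : RamState → Prop}
    (h : Runs p σ T fun τ => Runs q τ U Q) : Runs (.seq p q) σ (T + U) Q := by
  obtain ⟨τ, t, he, ht, ρ, u, he', hu, hq⟩ := h
  exact ⟨ρ, t + u, .seq he he', by omega, hq⟩

theorem Runs.branch {x : ℕ} {p q : RamProgram} {σ : RamState} {T : ℕ} {Q : RamState → Prop}
    (hp : σ.reg x ≠ 0 → Runs p σ T Q) (hq : σ.reg x = 0 → Runs q σ T Q) :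
    Runs (.branch x p q) σ (T + 1) Q := by
  by_cases h : σ.reg x = 0
  · obtain ⟨τ, t, he, ht, hq⟩ := hq h
    exact ⟨τ, t + 1, .branch_false h he, by omega, hq⟩
  · obtain ⟨τ, t, he, ht, hq⟩ := hp h
    exact ⟨τ, t + 1, .branch_true h he, by omega, hq⟩

/-- This reduces the loop-free pieces to a computation with `eval` that `simp` can carry out. -/
theorem Runs.of_eval {p : RamProgram} (hp : p.LoopFree) {σ : RamState} {Q : RamState → Prop}
    (h : Q (p.eval σ)) : Runs p σ p.size Q := by
  suffices ∃ t, RamExec p σ (p.eval σ) t ∧ t ≤ p.size from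
    let ⟨t, he, ht⟩ := this; ⟨_, t, he, ht, h⟩
  clear h
  induction p generalizing σ with
  | const x c => exact ⟨1, .const x c σ, le_rfl⟩
  | add x y z => exact ⟨1, .add x y z σ, le_rfl⟩
  | sub x y z => exact ⟨1, .sub x y z σ, le_rfl⟩
  | load x y => exact ⟨1, .load x y σ, le_rfl⟩
  | store x y => exact ⟨1, .store x y σ, le_rfl⟩
  | seq p q ihp ihq =>
    obtain ⟨t, he, ht⟩ := ihp hp.1 (σ := σ)
    obtain ⟨u, he', hu⟩ := ihq hp.2 (σ := p.eval σ)
    exact ⟨t + u, .seq he he', by simp only [RamProgram.size]; omega⟩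
  | branch x p q ihp ihq =>
    by_cases h : σ.reg x = 0
    · obtain ⟨u, he, hu⟩ := ihq hp.2 (σ := σ)
      refine ⟨u + 1, ?_, by simp only [RamProgram.size]; omega⟩
      rw [RamProgram.eval, if_pos h]
      exact .branch_false h he
    · obtain ⟨u, he, hu⟩ := ihp hp.1 (σ := σ)
      refine ⟨u + 1, ?_, by simp only [RamProgram.size]; omega⟩
      rw [RamProgram.eval, if_neg h]
      exact .branch_true h he
  | loop x p => exact hp.elim

/-- A loop whose body decreases a measure. -/
theorem Runs.loop {x : ℕ} {p : RamProgram} {T : ℕ} (J : ℕ → RamState → Prop)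
    (h : ∀ m σ, J m σ → σ.reg x ≠ 0 → Runs p σ T fun τ => ∃ m' < m, J m' τ) (m : ℕ) (σ : RamState)
    (hσ : J m σ) :
    Runs (.loop x p) σ (m * (T + 1) + 1) fun τ => τ.reg x = 0 ∧ ∃ m', J m' τ := by
  induction m using Nat.strong_induction_on generalizing σ with
  | _ m ih =>
    by_cases hx : σ.reg x = 0
    · exact ⟨σ, 1, .loop_done hx, by omega, hx, m, hσ⟩
    · obtain ⟨τ, t, he, ht, m', hm', hJ⟩ := h m σ hσ hx
      obtain ⟨ρ, u, he', hu, hq⟩ := ih m' hm' τ hJ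
      refine ⟨ρ, t + u + 1, .loop_step hx he he', ?_, hq⟩
      have : (m' + 1) * (T + 1) ≤ m * (T + 1) := Nat.mul_le_mul_right _ hm'
      rw [add_mul, one_mul] at this
      omega

/-- A loop whose body decrements the register `x`, which starts with the value `n`. -/
theorem Runs.count {x n : ℕ} {p : RamProgram} {T : ℕ} (J : ℕ → RamState → Prop)
    (h : ∀ w < n, ∀ σ, J w σ → σ.reg x = n - w →
      Runs p σ T fun τ => J (w + 1) τ ∧ τ.reg x = n - (w + 1)) {σ : RamState}
    (hσ : J 0 σ) (hx : σ.reg x = n) : Runs (.loop x p) σ (n * (T + 1) + 1) (J n) := by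
  refine (Runs.loop (T := T) (fun m σ => m ≤ n ∧ σ.reg x = m ∧ J (n - m) σ) ?_ n σ
    ⟨le_rfl, hx, by simpa using hσ⟩).mono le_rfl ?_
  · rintro m τ ⟨hm, hτ, hJ⟩ h0
    refine (h (n - m) (by omega) τ hJ (by omega)).mono le_rfl ?_
    rintro ρ ⟨hJ', hρ⟩
    refine ⟨m - 1, by omega, by omega, by omega, ?_⟩
    rwa [show n - (m - 1) = n - m + 1 by omega]
  · rintro τ ⟨h0, m, -, hm, hJ⟩
    rwa [← hm, h0, Nat.sub_zero] at hJ

/-! ### Path-based decomposition into strongly connected components -/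

/-- The invariant of the path-based algorithm for the links `E`. The label of a node is `0` before
the visit, a block number in `2, …, k` on the current path, and at least `n + 2` in the end. The row
`R p` marks the ends of the links out of the block `p`; the first row is that of a virtual root. -/
structure PathInvariant {n : ℕ} (E : Fin n → Fin n → Prop) (k D : ℕ) (L : Fin n → ℕ)
    (R : ℕ → Fin n → ℕ) : Prop where
  label : ∀ v, L v = 0 ∨ (2 ≤ L v ∧ L v ≤ k) ∨ (n + 2 ≤ L v ∧ L v < D)
  length : (Finset.univ.filter fun v => L v = 0).card + k ≤ n + 1
  reach : ∀ u v, 2 ≤ L u → L u ≤ L v → L v ≤ k → Relation.ReflTransGen E u v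
  closed : ∀ u v, n + 2 ≤ L u → E u v → n + 2 ≤ L v
  scc : ∀ u, n + 2 ≤ L u → ∀ v, L v = L u ↔
    Relation.ReflTransGen E u v ∧ Relation.ReflTransGen E v u
  root : 1 ≤ k → ∀ v, R 1 v ≠ 0
  row : ∀ p, 2 ≤ p → p ≤ k → ∀ v, R p v ≠ 0 → n + 2 ≤ L v ∨ ∃ u, L u = p ∧ E u v
  row_of_link : ∀ p, 2 ≤ p → p ≤ k → ∀ u v, L u = p → E u v → R p v ≠ 0
  visited : k = 0 → ∀ v, L v ≠ 0
  bound : n + 2 ≤ D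

namespace PathInvariant

variable {n : ℕ} {E : Fin n → Fin n → Prop} {k D : ℕ} {L L' : Fin n → ℕ} {R R' : ℕ → Fin n → ℕ}

/-- An unvisited end `v` of a link out of the last block becomes a block of its own. If the last
block is not the virtual root, its nodes and those of all earlier blocks reach `v` through this
link. -/
theorem push (h : PathInvariant E k D L R) (hk : 1 ≤ k) {v : Fin n} (hv : R k v ≠ 0) (hLv : L v = 0)
    (hL : ∀ w, L' w = if w = v then k + 1 else L w) (hR : ∀ p ≤ k, R' p = R p)
    (hR' : ∀ w, R' (k + 1) w ≠ 0 ↔ E v w) :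
    PathInvariant E (k + 1) D L' R' ∧
      (Finset.univ.filter fun v => L' v = 0).card + 1 =
        (Finset.univ.filter fun v => L v = 0).card := by
  have hcard : (Finset.univ.filter fun v => L' v = 0).card + 1 =
      (Finset.univ.filter fun v => L v = 0).card := by
    have : Finset.univ.filter (fun v => L' v = 0) = (Finset.univ.filter fun v => L v = 0).erase v := by
      ext w
      simp only [Finset.mem_filter, Finset.mem_univ, true_and, Finset.mem_erase, hL]
      by_cases hw : w = v <;> simp [hw]
    rw [this, Finset.card_erase_add_one (by simpa using hLv)]
  have hLv' : L' v = k + 1 := by rw [hL, if_pos rfl]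
  have hLw : ∀ w, w ≠ v → L' w = L w := fun w hw => by rw [hL, if_neg hw]
  have hlen := h.length
  have hkn : k + 1 < n + 2 := by omega
  have hdone : ∀ w, n + 2 ≤ L' w → w ≠ v ∧ n + 2 ≤ L w := by
    intro w hw
    by_cases hwv : w = v
    · subst hwv
      omega
    · rw [hLw w hwv] at hw
      exact ⟨hwv, hw⟩
  have hdone' : ∀ w, n + 2 ≤ L w → n + 2 ≤ L' w := by
    intro w hw
    rwa [hLw w (by rintro rfl; omega)]
  refine ⟨⟨fun w => ?_, by omega, fun u w hu huw hw => ?_, fun u w hu huw => ?_, fun u hu w => ?_,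
    fun _ w => ?_, fun p hp hpk w hw => ?_, fun p hp hpk u w hu huw => ?_, fun h0 => by omega,
    h.bound⟩, hcard⟩
  · by_cases hwv : w = v
    · subst hwv
      omega
    · rw [hLw w hwv]
      have := h.label w
      omega
  · by_cases huv : u = v
    · by_cases hwv : w = v
      · rw [huv, hwv]
      · rw [hLw w hwv] at huw hw
        have := h.label w
        rw [huv] at huw
        omega
    · rw [hLw u huv] at hu huw
      by_cases hwv : w = v
      · rw [hwv] at huw ⊢
        have := h.label u
        obtain ⟨x, hx, hxv⟩ := (h.row k (by omega) le_rfl v hv).resolve_left (by omega)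
        exact (h.reach u x hu (by omega) hx.le).tail hxv
      · rw [hLw w hwv] at huw hw
        have := h.label w
        exact h.reach u w hu huw (by omega)
  · exact hdone' w (h.closed u w (hdone u hu).2 huw)
  · obtain ⟨huv, hu'⟩ := hdone u hu
    rw [← h.scc u hu' w, hLw u huv]
    by_cases hwv : w = v
    · rw [hwv]
      omega
    · rw [hLw w hwv]
  · rw [hR 1 hk]
    exact h.root hk w
  · rcases Nat.lt_or_ge k p with hkp | hkp
    · obtain rfl : p = k + 1 := by omega
      exact Or.inr ⟨v, hLv', (hR' w).1 hw⟩
    · rw [hR p hkp] at hw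
      rcases h.row p hp hkp w hw with h1 | ⟨u, hu, huw⟩
      · exact Or.inl (hdone' w h1)
      · exact Or.inr ⟨u, by rw [hLw u (by rintro rfl; omega), hu], huw⟩
  · by_cases huv : u = v
    · subst huv
      obtain rfl : p = k + 1 := by omega
      exact (hR' w).2 huw
    · rw [hLw u huv] at hu
      have := h.label u
      rw [hR p (by omega)]
      exact h.row_of_link p hp (by omega) u w hu huw

theorem card_relabel (hk : 1 ≤ k) {a : ℕ} (ha : a ≠ 0)
    (hL : ∀ w, L' w = if L w = k then a else L w) :
    (Finset.univ.filter fun v => L' v = 0).card = (Finset.univ.filter fun v => L v = 0).card := by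
  congr 1
  ext w
  simp only [Finset.mem_filter, Finset.mem_univ, true_and, hL]
  split_ifs <;> omega

/-- A link back to an earlier block closes a cycle through all blocks from there to the last. Only
the last two are united at once; a longer cycle is contracted by further merges. -/
theorem merge (h : PathInvariant E k D L R) {v : Fin n} (hv : R k v ≠ 0) (hLv : L v ≠ 0)
    (hLk : L v < k) (hL : ∀ w, L' w = if L w = k then k - 1 else L w)
    (hR : ∀ p < k - 1, R' p = R p) (hR' : ∀ w, R' (k - 1) w = R (k - 1) w + R k w) :
    PathInvariant E (k - 1) (D + 1) L' R' := by
  have hlen := h.length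
  have hbd := h.bound
  have hv2 : 2 ≤ L v := by
    have := h.label v
    omega
  have hcard := card_relabel (by omega) (a := k - 1) (by omega) hL
  obtain ⟨x, hx, hxv⟩ := (h.row k (by omega) le_rfl v hv).resolve_left (by omega)
  have hdone : ∀ w, n + 2 ≤ L' w ↔ n + 2 ≤ L w := by
    intro w
    rw [hL]
    split_ifs <;> omega
  refine ⟨fun w => ?_, by omega, fun u w hu huw hw => ?_, fun u w hu huw => ?_, fun u hu w => ?_,
    fun _ w => ?_, fun p hp hpk w hw => ?_, fun p hp hpk u w hu huw => ?_, fun h0 => by omega,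
    by omega⟩
  · have := h.label w
    rw [hL]
    split_ifs <;> omega
  · have h1 := h.label u
    have h2 := h.label w
    rw [hL] at hu
    rw [hL, hL] at huw
    rw [hL] at hw
    by_cases huk : L u = k
    · by_cases hwk : L w = k
      · exact h.reach u w (by omega) (by omega) (by omega)
      · rw [if_pos huk, if_neg hwk] at huw
        rw [if_neg hwk] at hw
        exact ((h.reach u x (by omega) (by omega) (by omega)).tail hxv).trans
          (h.reach v w hv2 (by omega) (by omega))
    · rw [if_neg huk] at hu huw
      split_ifs at huw hw with hwk
      · exact h.reach u w hu (by omega) (by omega)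
      · exact h.reach u w hu (by omega) (by omega)
  · exact (hdone w).2 (h.closed u w ((hdone u).1 hu) huw)
  · have hu' := (hdone u).1 hu
    rw [← h.scc u hu' w, hL, hL, if_neg (show L u ≠ k by omega)]
    split_ifs <;> omega
  · have h1 := h.root (by omega) w
    rcases Nat.lt_or_ge 1 (k - 1) with hk1 | hk1
    · rwa [hR 1 hk1]
    · have : k - 1 = 1 := by omega
      rw [← this, hR', this]
      omega
  · rcases Nat.lt_or_ge p (k - 1) with hpk' | hpk'
    · rw [hR p hpk'] at hw
      rcases h.row p hp (by omega) w hw with h1 | ⟨u, hu, huw⟩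
      · exact Or.inl ((hdone w).2 h1)
      · exact Or.inr ⟨u, by rw [hL, if_neg (by omega), hu], huw⟩
    · obtain rfl : p = k - 1 := by omega
      rw [hR'] at hw
      have hw' : R (k - 1) w ≠ 0 ∨ R k w ≠ 0 := by omega
      rcases hw' with hw' | hw'
      · rcases h.row (k - 1) hp (by omega) w hw' with h1 | ⟨u, hu, huw⟩
        · exact Or.inl ((hdone w).2 h1)
        · exact Or.inr ⟨u, by rw [hL, if_neg (by omega), hu], huw⟩
      · rcases h.row k (by omega) le_rfl w hw' with h1 | ⟨u, hu, huw⟩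
        · exact Or.inl ((hdone w).2 h1)
        · exact Or.inr ⟨u, by rw [hL, if_pos hu], huw⟩
  · rw [hL] at hu
    by_cases huk : L u = k
    · rw [if_pos huk] at hu
      have := h.row_of_link k (by omega) le_rfl u w huk huw
      rw [← hu, hR']
      omega
    · rw [if_neg huk] at hu
      have := h.row_of_link p hp (by omega) u w hu huw
      rcases Nat.lt_or_ge p (k - 1) with hpk' | hpk'
      · rwa [hR p hpk']
      · obtain rfl : p = k - 1 := by omega
        rw [hR']
        omega

/-- All links out of the last block end in itself or at finished nodes, and no finished node leads
back, so it is a component and gets the fresh label `D`. Its row is still added to the previous one,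
harmlessly, as its ends are finished now. -/
theorem finish (h : PathInvariant E k D L R) (hk : 1 ≤ k) (hv : ∀ v, R k v ≠ 0 → k ≤ L v)
    (hL : ∀ w, L' w = if L w = k then D else L w)
    (hR : ∀ p < k - 1, R' p = R p) (hR' : ∀ w, R' (k - 1) w = R (k - 1) w + R k w) :
    PathInvariant E (k - 1) (D + 1) L' R' := by
  have hlen := h.length
  have hbd := h.bound
  have hcard := card_relabel hk (a := D) (by omega) hL
  have hdone : ∀ w, n + 2 ≤ L w → n + 2 ≤ L' w := by
    intro w hw
    rw [hL]
    split_ifs <;> omega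
  have hdone' : ∀ w, n + 2 ≤ L' w → L w = k ∨ n + 2 ≤ L w := by
    intro w
    rw [hL]
    split_ifs <;> omega
  have hout : ∀ u w, L u = k → E u w → L w = k ∨ n + 2 ≤ L w := by
    intro u w hu huw
    have h1 := h.label u
    have := hv w (h.row_of_link k (by omega) le_rfl u w hu huw)
    have := h.label w
    omega
  have hreach : ∀ u w, L u = k ∨ n + 2 ≤ L u → Relation.ReflTransGen E u w →
      L w = k ∨ n + 2 ≤ L w := by
    intro u w hu huw
    induction huw with
    | refl => exact hu
    | tail _ hab ih =>
      rcases ih with ih | ih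
      · exact hout _ _ ih hab
      · exact Or.inr (h.closed _ _ ih hab)
  have hreach' : ∀ u w, n + 2 ≤ L u → Relation.ReflTransGen E u w → n + 2 ≤ L w := by
    intro u w hu huw
    induction huw with
    | refl => exact hu
    | tail _ hab ih => exact h.closed _ _ ih hab
  refine ⟨fun w => ?_, by omega, fun u w hu huw hw => ?_, fun u w hu huw => ?_, fun u hu w => ?_,
    fun h1 w => ?_, fun p hp hpk w hw => ?_, fun p hp hpk u w hu huw => ?_, fun h0 w => ?_,
    by omega⟩
  · have := h.label w
    rw [hL]
    split_ifs <;> omega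
  · have h1 := h.label u
    have h2 := h.label w
    rw [hL] at hu
    rw [hL, hL] at huw
    rw [hL] at hw
    split_ifs at hu huw hw
    all_goals first
      | omega
      | exact h.reach u w (by omega) (by omega) (by omega)
  · rw [hL]
    rcases hdone' u hu with h1 | h1
    · rcases hout u w h1 huw with h2 | h2
      · rw [if_pos h2]
        exact hbd
      · split_ifs <;> omega
    · have := h.closed u w h1 huw
      split_ifs <;> omega
  · rcases hdone' u hu with h1 | h1
    · have hu2 := h.label u
      rw [hL, hL, if_pos h1]
      constructor
      · intro hw
        have h2 := h.label w
        split_ifs at hw with hwk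
        · exact ⟨h.reach u w (by omega) (by omega) (by omega),
            h.reach w u (by omega) (by omega) (by omega)⟩
        · omega
      · rintro ⟨h2, h3⟩
        rcases hreach u w (Or.inl h1) h2 with h4 | h4
        · rw [if_pos h4]
        · have := hreach' w u h4 h3
          omega
    · have h2 := h.label u
      rw [← h.scc u h1 w, hL, hL, if_neg (show L u ≠ k by omega)]
      split_ifs <;> omega
  · have h2 := h.root hk w
    rcases Nat.lt_or_ge 1 (k - 1) with hk1 | hk1
    · rwa [hR 1 hk1]
    · have : k - 1 = 1 := by omega
      rw [← this, hR', this]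
      omega
  · rcases Nat.lt_or_ge p (k - 1) with hpk' | hpk'
    · rw [hR p hpk'] at hw
      rcases h.row p hp (by omega) w hw with h1 | ⟨u, hu, huw⟩
      · exact Or.inl (hdone w h1)
      · exact Or.inr ⟨u, by rw [hL, if_neg (by omega), hu], huw⟩
    · obtain rfl : p = k - 1 := by omega
      rw [hR'] at hw
      have hw' : R (k - 1) w ≠ 0 ∨ R k w ≠ 0 := by omega
      rcases hw' with hw' | hw'
      · rcases h.row (k - 1) hp (by omega) w hw' with h1 | ⟨u, hu, huw⟩
        · exact Or.inl (hdone w h1)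
        · exact Or.inr ⟨u, by rw [hL, if_neg (by omega), hu], huw⟩
      · have h1 := hv w hw'
        have h2 := h.label w
        left
        rw [hL]
        split_ifs <;> omega
  · rw [hL] at hu
    split_ifs at hu with huk
    · omega
    · have := h.row_of_link p hp (by omega) u w hu huw
      rcases Nat.lt_or_ge p (k - 1) with hpk' | hpk'
      · rwa [hR p hpk']
      · obtain rfl : p = k - 1 := by omega
        rw [hR']
        omega
  -- The virtual root marks every node, so when it is removed no node is left unvisited.
  · obtain rfl : k = 1 := by omega
    have h1 := hv w (h.root le_rfl w)
    rw [hL]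
    split_ifs <;> omega

/-- When the path is empty, the labels describe the strongly connected components. -/
theorem label_eq_iff (h : PathInvariant E 0 D L R) (u v : Fin n) :
    L u = L v ↔ Relation.ReflTransGen E u v ∧ Relation.ReflTransGen E v u := by
  have h1 := h.label v
  have h2 := h.visited rfl v
  rw [h.scc v (by omega) u]
  exact and_comm

theorem init (hn : n + 2 ≤ D) (hL : ∀ v, L v = 0) (hR : ∀ v, R 1 v ≠ 0) :
    PathInvariant E 1 D L R where
  label v := Or.inl (hL v)
  length := by simp [hL]
  reach u _ hu := by simp [hL] at hu
  closed u _ hu := by simp [hL] at hu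
  scc u hu := by simp [hL] at hu
  root _ := hR
  row p hp hp1 := by omega
  row_of_link p hp hp1 := by omega
  visited h := by omega
  bound := hn

end PathInvariant

set_option linter.unusedSimpArgs false

/-! ### The program -/

-- Registers: `r₂ = 1`, `r₃ = n²`, `r₄ = k`, `r₅` the address of row `k`, `r₆` the next fresh label,
-- `r₇` the loop counter, and `r₁₅ = 0`, so that adding it copies a register. Assigning `r₁₄` serves
-- as an empty instruction. The input is followed by `n` labels and `n` output cells; row `p` starts
-- at `n² + 2n + pn`.
namespace RamProgram

/-- The programs of a list, one after the other. -/
def ofList : List RamProgram → RamProgram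
  | [] => .const 14 0
  | p :: l => .seq p (ofList l)

/-- Adds `r₀` to `r₃` and decrements `r₇`. -/
def squareBody : RamProgram := ofList [.add 3 3 0, .sub 7 7 2]

/-- Writes `1` to the cell `r₉`. -/
def fillBody : RamProgram := ofList [.store 9 2, .add 9 9 2, .sub 7 7 2]

/-- Looks for a node outside of the last block that the last block has a link to. -/
def scanBody : RamProgram := ofList [.load 14 9,
  .branch 14 (ofList [.load 14 10, .sub 16 4 14,
    .branch 16 (ofList [.const 8 1, .add 12 11 15, .add 13 10 15, .add 17 14 15]) (.const 14 0)])
    (.const 14 0),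
  .add 9 9 2, .add 10 10 2, .add 11 11 0, .sub 7 7 2]

/-- Copies the cell `r₁₀` to the cell `r₉`. -/
def copyBody : RamProgram := ofList [.load 14 10, .store 9 14, .add 9 9 2, .add 10 10 2, .sub 7 7 2]

/-- Adds the cell `r₉` to the cell `r₂₀`, and relabels the cell `r₁₀` from `r₄` to `r₁₉`. -/
def popBody : RamProgram := ofList [.load 14 9, .load 16 20, .load 8 10, .add 16 16 14,
  .store 20 16, .sub 16 8 4, .sub 18 4 8, .add 16 16 18,
  .branch 16 (.const 14 0) (.store 10 19),
  .add 9 9 2, .add 20 20 2, .add 10 10 2, .sub 7 7 2]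

/-- Writes to the cell `r₉` whether the cell `r₁₀ ≠ r₁₁` has the label `r₁₂`. -/
def indicatorBody : RamProgram := ofList [.load 14 10, .sub 16 14 12, .sub 18 12 14, .add 16 16 18,
  .sub 17 10 11, .sub 18 11 10, .add 17 17 18,
  .branch 16 (.store 9 15) (.branch 17 (.store 9 2) (.store 9 15)),
  .add 9 9 2, .add 10 10 2, .sub 7 7 2]

/-- Pushes the node found by the scan. -/
def push : RamProgram := .seq
  (ofList [.add 4 4 2, .add 5 5 0, .store 13 4, .add 9 5 15, .add 10 12 15, .add 7 0 15])
  (.loop 7 copyBody)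

/-- Removes the last block, relabelled to `r₁₉`. -/
def pop : RamProgram := .seq (ofList [.add 7 0 15, .add 9 5 15, .sub 20 5 0, .add 10 3 15])
  (.seq (.loop 7 popBody) (ofList [.sub 4 4 2, .sub 5 5 0, .add 6 6 2]))

/-- One step of the path-based algorithm. -/
def pathStep : RamProgram := .seq
  (ofList [.add 7 0 15, .const 8 0, .add 9 5 15, .add 10 3 15, .const 11 0])
  (.seq (.loop 7 scanBody)
    (.branch 8 (.branch 17 (.seq (.sub 19 4 2) pop) push) (.seq (.add 19 6 15) pop)))

/-- The search for the states equivalent to a state. -/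
def equivalent : RamProgram := .seq (ofList [.const 2 1, .add 7 0 15]) (.seq (.loop 7 squareBody)
  (.seq (ofList [.add 5 3 0, .add 5 5 0, .add 5 5 0, .const 4 1, .add 6 0 2, .add 6 6 2,
    .add 7 0 15, .add 9 5 15]) (.seq (.loop 7 fillBody) (.seq (.loop 4 pathStep)
  (.seq (ofList [.add 7 0 15, .add 10 3 15, .add 9 3 0, .add 11 3 1, .load 12 11])
    (.loop 7 indicatorBody))))))

end RamProgram

/-! ### Correctness and running time of the loops. -/

open RamProgram

/-- The contents of the registers between the inner loops. -/
structure PathRegisters (n i k D : ℕ) (σ : RamState) : Prop where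
  r0 : σ.reg 0 = n
  r1 : σ.reg 1 = i
  r2 : σ.reg 2 = 1
  r3 : σ.reg 3 = n ^ 2
  r4 : σ.reg 4 = k
  r5 : σ.reg 5 = n ^ 2 + 2 * n + k * n
  r6 : σ.reg 6 = D
  r15 : σ.reg 15 = 0

/-- The outcome of the scan of the first `w` nodes, where the cells `row + v` mark the ends of the
links and the cells `q + v` hold the labels. -/
def ScanResult (m : ℕ → ℕ) (row q n k w found a b c : ℕ) : Prop :=
  (found = 0 ∧ ∀ v < w, m (row + v) ≠ 0 → k ≤ m (q + v)) ∨
    (found ≠ 0 ∧ ∃ v < w, m (row + v) ≠ 0 ∧ m (q + v) < k ∧ a = v * n ∧ b = q + v ∧ c = m (q + v))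

theorem ScanResult.skip {m : ℕ → ℕ} {row q n k w found a b c : ℕ}
    (h : ScanResult m row q n k w found a b c) (hw : m (row + w) = 0 ∨ k ≤ m (q + w)) :
    ScanResult m row q n k (w + 1) found a b c := by
  rcases h with ⟨h1, h2⟩ | ⟨h1, v, h2, h3⟩
  · refine Or.inl ⟨h1, fun v hv hne => ?_⟩
    rcases Nat.lt_succ_iff_lt_or_eq.1 hv with hv | rfl
    · exact h2 v hv hne
    · exact hw.resolve_left hne
  · exact Or.inr ⟨h1, v, h2.trans (Nat.lt_succ_self w), h3⟩

theorem runs_scan {n i k D : ℕ} {σ : RamState} (h : PathRegisters n i k D σ) (h7 : σ.reg 7 = n)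
    (h8 : σ.reg 8 = 0) (h9 : σ.reg 9 = n ^ 2 + 2 * n + k * n) (h10 : σ.reg 10 = n ^ 2)
    (h11 : σ.reg 11 = 0) :
    Runs (.loop 7 scanBody) σ (n * (scanBody.size + 1) + 1) fun τ =>
      PathRegisters n i k D τ ∧ τ.mem = σ.mem ∧
      ScanResult σ.mem (n ^ 2 + 2 * n + k * n) (n ^ 2) n k n (τ.reg 8) (τ.reg 12) (τ.reg 13)
        (τ.reg 17) := by
  refine (Runs.count (fun w τ => PathRegisters n i k D τ ∧ τ.mem = σ.mem ∧
      τ.reg 9 = n ^ 2 + 2 * n + k * n + w ∧ τ.reg 10 = n ^ 2 + w ∧ τ.reg 11 = w * n ∧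
      ScanResult σ.mem (n ^ 2 + 2 * n + k * n) (n ^ 2) n k w (τ.reg 8) (τ.reg 12) (τ.reg 13)
        (τ.reg 17))
    ?_ ⟨h, rfl, by simpa using h9, by simpa using h10, by simpa using h11, Or.inl ⟨h8, by simp⟩⟩
    h7).mono le_rfl fun τ hτ => ⟨hτ.1, hτ.2.1, hτ.2.2.2.2.2⟩
  rintro w hw τ ⟨⟨r0, r1, r2, r3, r4, r5, r6, r15⟩, hm, t9, t10, t11, hf⟩ t7
  refine Runs.of_eval (by simp [LoopFree, scanBody, ofList]) ?_
  have hstep : (w + 1) * n = w * n + n := by ring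
  by_cases hA : σ.mem (n ^ 2 + 2 * n + k * n + w) = 0
  · refine ⟨⟨⟨?_, ?_, ?_, ?_, ?_, ?_, ?_, ?_⟩, ?_, ?_, ?_, ?_, ?_⟩, ?_⟩
    all_goals simp [scanBody, ofList, eval, RamState.setReg, Function.update_apply, hm, t9, t10,
      t11, t7, r0, r1, r2, r3, r4, r5, r6, r15, hA]
    · rfl
    · rfl
    · exact hstep.symm
    · exact hf.skip (Or.inl hA)
    · omega
  -- One truncated difference decides: labels below `k` are those of unvisited nodes and earlier
  -- blocks, while the last block and all finished nodes have labels at least `k`.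
  · by_cases hB : k - σ.mem (n ^ 2 + w) = 0
    · have hB' := Nat.sub_eq_zero_iff_le.1 hB
      refine ⟨⟨⟨?_, ?_, ?_, ?_, ?_, ?_, ?_, ?_⟩, ?_, ?_, ?_, ?_, ?_⟩, ?_⟩
      all_goals simp [scanBody, ofList, eval, RamState.setReg, Function.update_apply, hm, t9, t10,
        t11, t7, r0, r1, r2, r3, r4, r5, r6, r15, hA, hB']
      · rfl
      · rfl
      · exact hstep.symm
      · exact hf.skip (Or.inr hB')
      · omega
    · have hB' : ¬ k ≤ σ.mem (n ^ 2 + w) := fun h => hB (Nat.sub_eq_zero_of_le h)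
      refine ⟨⟨⟨?_, ?_, ?_, ?_, ?_, ?_, ?_, ?_⟩, ?_, ?_, ?_, ?_, ?_⟩, ?_⟩
      all_goals simp [scanBody, ofList, eval, RamState.setReg, Function.update_apply, hm, t9, t10,
        t11, t7, r0, r1, r2, r3, r4, r5, r6, r15, hA, hB, hB']
      · rfl
      · rfl
      · exact hstep.symm
      · exact Or.inr ⟨one_ne_zero, w, Nat.lt_succ_self w, hA, not_le.1 hB', rfl, rfl, rfl⟩
      · omega

theorem runs_pop_loop {n i k D a : ℕ} {σ : RamState} (h : PathRegisters n i k D σ) (hk : 1 ≤ k)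
    (h7 : σ.reg 7 = n)
    (h9 : σ.reg 9 = n ^ 2 + 2 * n + k * n) (h20 : σ.reg 20 = n ^ 2 + 2 * n + (k - 1) * n)
    (h10 : σ.reg 10 = n ^ 2) (h19 : σ.reg 19 = a) :
    Runs (.loop 7 popBody) σ (n * (popBody.size + 1) + 1) fun τ =>
      PathRegisters n i k D τ ∧ ∀ b, τ.mem b =
        if n ^ 2 ≤ b ∧ b < n ^ 2 + n then (if σ.mem b = k then a else σ.mem b)
        else if n ^ 2 + 2 * n + (k - 1) * n ≤ b ∧ b < n ^ 2 + 2 * n + k * n then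
          σ.mem b + σ.mem (b + n) else σ.mem b := by
  obtain ⟨j, rfl⟩ : ∃ j, k = j + 1 := ⟨k - 1, by omega⟩
  rw [Nat.add_sub_cancel] at h20 ⊢
  -- The base addresses are made opaque so that all address comparisons are linear.
  obtain ⟨q, hq⟩ : ∃ q, q = n ^ 2 := ⟨_, rfl⟩
  obtain ⟨row, hrow⟩ : ∃ row, row = n ^ 2 + 2 * n + j * n := ⟨_, rfl⟩
  have hrow' : n ^ 2 + 2 * n + (j + 1) * n = row + n := by rw [hrow]; ring
  have hqrow : q + 2 * n ≤ row := by rw [hrow, hq]; omega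
  rw [hrow'] at h9 ⊢
  rw [← hrow] at h20 ⊢
  rw [← hq] at h10 ⊢
  refine (Runs.count (fun w τ => PathRegisters n i (j + 1) D τ ∧ τ.reg 9 = row + n + w ∧
      τ.reg 20 = row + w ∧ τ.reg 10 = q + w ∧ τ.reg 19 = a ∧
      ∀ b, τ.mem b =
        if q ≤ b ∧ b < q + w then (if σ.mem b = j + 1 then a else σ.mem b)
        else if row ≤ b ∧ b < row + w then σ.mem b + σ.mem (b + n) else σ.mem b)
    ?_ ⟨h, by simpa using h9, by simpa using h20, by simpa using h10, h19, fun b => ?_⟩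
    h7).mono le_rfl fun τ hτ => ⟨hτ.1, hτ.2.2.2.2.2⟩
  · rintro w hw τ ⟨⟨r0, r1, r2, r3, r4, r5, r6, r15⟩, t9, t20, t10, t19, hm⟩ t7
    refine Runs.of_eval (by simp [LoopFree, popBody, ofList]) ?_
    have m1 : τ.mem (row + n + w) = σ.mem (row + n + w) := by
      rw [hm, if_neg (by omega), if_neg (by omega)]
    have m2 : τ.mem (row + w) = σ.mem (row + w) := by
      rw [hm, if_neg (by omega), if_neg (by omega)]
    have m3 : τ.mem (q + w) = σ.mem (q + w) := by
      rw [hm, if_neg (by omega), if_neg (by omega)]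
    have hmem : ∀ b, (if b = q + w then (if σ.mem (q + w) = j + 1 then a else σ.mem (q + w))
        else if b = row + w then σ.mem (row + w) + σ.mem (row + n + w) else τ.mem b) =
        if q ≤ b ∧ b < q + (w + 1) then (if σ.mem b = j + 1 then a else σ.mem b)
        else if row ≤ b ∧ b < row + (w + 1) then σ.mem b + σ.mem (b + n) else σ.mem b := by
      intro b
      by_cases h1 : b = q + w
      · rw [if_pos h1, h1, if_pos (show q ≤ q + w ∧ q + w < q + (w + 1) by omega)]
      · rw [if_neg h1]
        by_cases h2 : b = row + w
        · rw [if_pos h2, h2, if_neg (by omega), if_pos (by omega), add_right_comm]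
        · rw [if_neg h2, hm]
          refine if_congr (by omega) rfl (if_congr (by omega) rfl rfl)
    by_cases hB : σ.mem (q + w) = j + 1
    · refine ⟨⟨⟨?_, ?_, ?_, ?_, ?_, ?_, ?_, ?_⟩, ?_, ?_, ?_, ?_, ?_⟩, ?_⟩
      all_goals simp [popBody, ofList, eval, RamState.setReg, RamState.setMem,
        Function.update_apply, t9, t10, t19, t20, t7, r0, r1, r2, r3, r4, r5, r6, r15, m1, m2, m3,
        hB]
      · rfl
      · rfl
      · rfl
      · intro b
        rw [← hmem b, if_pos hB]
      · omega
    · have hB' : σ.mem (q + w) - (j + 1) + (j + 1 - σ.mem (q + w)) ≠ 0 := by omega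
      refine ⟨⟨⟨?_, ?_, ?_, ?_, ?_, ?_, ?_, ?_⟩, ?_, ?_, ?_, ?_, ?_⟩, ?_⟩
      all_goals simp [popBody, ofList, eval, RamState.setReg, RamState.setMem,
        Function.update_apply, t9, t10, t19, t20, t7, r0, r1, r2, r3, r4, r5, r6, r15, m1, m2, m3,
        hB', -Nat.add_eq_zero_iff, -add_eq_zero]
      · rfl
      · rfl
      · rfl
      · intro b
        rw [← hmem b, if_neg hB]
        by_cases h1 : b = q + w
        · rw [if_neg (by omega), if_pos h1, h1, m3]
        · rw [if_neg h1]
      · omega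
  · rw [if_neg (by omega), if_neg (by omega)]

theorem Runs.seq_eval {p q : RamProgram} (hp : p.LoopFree) {σ : RamState} {T : ℕ}
    {Q : RamState → Prop} (h : Runs q (p.eval σ) T Q) : Runs (.seq p q) σ (p.size + T) Q :=
  (Runs.of_eval hp h).seq

theorem runs_square_loop {n : ℕ} {σ : RamState} (h0 : σ.reg 0 = n) (h2 : σ.reg 2 = 1)
    (h3 : σ.reg 3 = 0) (h7 : σ.reg 7 = n) :
    Runs (.loop 7 squareBody) σ (n * (squareBody.size + 1) + 1) fun τ =>
      τ.reg 0 = n ∧ τ.reg 1 = σ.reg 1 ∧ τ.reg 2 = 1 ∧ τ.reg 3 = n ^ 2 ∧ τ.reg 15 = σ.reg 15 ∧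
        τ.mem = σ.mem := by
  rw [pow_two]
  refine Runs.count (fun w τ => τ.reg 0 = n ∧ τ.reg 1 = σ.reg 1 ∧ τ.reg 2 = 1 ∧ τ.reg 3 = w * n ∧
    τ.reg 15 = σ.reg 15 ∧ τ.mem = σ.mem) ?_ ⟨h0, rfl, h2, by simpa using h3, rfl, rfl⟩ h7
  rintro w hw τ ⟨r0, r1, r2, r3, r15, hm⟩ t7
  refine Runs.of_eval (by simp [LoopFree, squareBody, ofList]) ?_
  refine ⟨⟨?_, ?_, ?_, ?_, ?_, ?_⟩, ?_⟩
  all_goals simp [squareBody, ofList, eval, RamState.setReg, Function.update_apply, hm, t7, r0, r1,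
    r2, r3, r15]
  · ring
  · omega

theorem runs_fill_loop {n i k D d : ℕ} {σ : RamState} (h : PathRegisters n i k D σ)
    (h7 : σ.reg 7 = n) (h9 : σ.reg 9 = d) :
    Runs (.loop 7 fillBody) σ (n * (fillBody.size + 1) + 1) fun τ =>
      PathRegisters n i k D τ ∧ ∀ b, τ.mem b = if d ≤ b ∧ b < d + n then 1 else σ.mem b := by
  refine (Runs.count (fun w τ => PathRegisters n i k D τ ∧ τ.reg 9 = d + w ∧
      ∀ b, τ.mem b = if d ≤ b ∧ b < d + w then 1 else σ.mem b)
    ?_ ⟨h, h9, fun b => ?_⟩ h7).mono le_rfl fun τ hτ => ⟨hτ.1, hτ.2.2⟩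
  · rintro w hw τ ⟨⟨r0, r1, r2, r3, r4, r5, r6, r15⟩, t9, hm⟩ t7
    refine Runs.of_eval (by simp [LoopFree, fillBody, ofList]) ?_
    refine ⟨⟨⟨?_, ?_, ?_, ?_, ?_, ?_, ?_, ?_⟩, ?_, ?_⟩, ?_⟩
    all_goals simp [fillBody, ofList, eval, RamState.setReg, RamState.setMem,
      Function.update_apply, t9, t7, r0, r1, r2, r3, r4, r5, r6, r15]
    · rfl
    · intro b
      rw [hm]
      by_cases hb : b = d + w
      · rw [if_pos hb, if_pos (by omega)]
      · rw [if_neg hb]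
        exact if_congr (by omega) rfl rfl
    · omega
  · rw [if_neg (by omega)]

theorem runs_copy_loop {n i k D d s : ℕ} {σ : RamState} (h : PathRegisters n i k D σ)
    (h7 : σ.reg 7 = n) (h9 : σ.reg 9 = d) (h10 : σ.reg 10 = s) (hsd : s + n ≤ d) :
    Runs (.loop 7 copyBody) σ (n * (copyBody.size + 1) + 1) fun τ =>
      PathRegisters n i k D τ ∧
        ∀ b, τ.mem b = if d ≤ b ∧ b < d + n then σ.mem (s + (b - d)) else σ.mem b := by
  refine (Runs.count (fun w τ => PathRegisters n i k D τ ∧ τ.reg 9 = d + w ∧ τ.reg 10 = s + w ∧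
      ∀ b, τ.mem b = if d ≤ b ∧ b < d + w then σ.mem (s + (b - d)) else σ.mem b)
    ?_ ⟨h, h9, h10, fun b => ?_⟩ h7).mono le_rfl fun τ hτ => ⟨hτ.1, hτ.2.2.2⟩
  · rintro w hw τ ⟨⟨r0, r1, r2, r3, r4, r5, r6, r15⟩, t9, t10, hm⟩ t7
    refine Runs.of_eval (by simp [LoopFree, copyBody, ofList]) ?_
    have m1 : τ.mem (s + w) = σ.mem (s + w) := by
      rw [hm, if_neg (by omega)]
    refine ⟨⟨⟨?_, ?_, ?_, ?_, ?_, ?_, ?_, ?_⟩, ?_, ?_, ?_⟩, ?_⟩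
    all_goals simp [copyBody, ofList, eval, RamState.setReg, RamState.setMem,
      Function.update_apply, t9, t10, t7, r0, r1, r2, r3, r4, r5, r6, r15, m1]
    · rfl
    · rfl
    · intro b
      rw [hm]
      by_cases hb : b = d + w
      · rw [if_pos hb, if_pos (by omega), hb, Nat.add_sub_cancel_left]
      · rw [if_neg hb]
        exact if_congr (by omega) rfl rfl
    · omega
  · rw [if_neg (by omega)]

theorem runs_indicator_loop {n q i a : ℕ} {σ : RamState} (h2 : σ.reg 2 = 1) (h15 : σ.reg 15 = 0)
    (h7 : σ.reg 7 = n) (h9 : σ.reg 9 = q + n) (h10 : σ.reg 10 = q) (h11 : σ.reg 11 = q + i)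
    (h12 : σ.reg 12 = a) :
    Runs (.loop 7 indicatorBody) σ (n * (indicatorBody.size + 1) + 1) fun τ =>
      (∀ b < q + n, τ.mem b = σ.mem b) ∧
        ∀ v < n, τ.mem (q + n + v) = if σ.mem (q + v) = a ∧ v ≠ i then 1 else 0 := by
  refine (Runs.count (fun w τ => τ.reg 2 = 1 ∧ τ.reg 15 = 0 ∧ τ.reg 9 = q + n + w ∧
      τ.reg 10 = q + w ∧ τ.reg 11 = q + i ∧ τ.reg 12 = a ∧ (∀ b < q + n, τ.mem b = σ.mem b) ∧
        ∀ v < w, τ.mem (q + n + v) = if σ.mem (q + v) = a ∧ v ≠ i then 1 else 0)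
    ?_ ⟨h2, h15, h9, h10, h11, h12, fun b _ => rfl, by simp⟩ h7).mono le_rfl
    fun τ hτ => hτ.2.2.2.2.2.2
  rintro w hw τ ⟨r2, r15, t9, t10, t11, t12, hm, hm'⟩ t7
  refine Runs.of_eval (by simp [LoopFree, indicatorBody, ofList]) ?_
  have m1 : τ.mem (q + w) = σ.mem (q + w) := hm _ (by omega)
  have hval : ∃ τ' : RamState, indicatorBody.eval τ = τ' ∧ τ'.reg 2 = 1 ∧ τ'.reg 15 = 0 ∧
      τ'.reg 9 = q + n + (w + 1) ∧ τ'.reg 10 = q + (w + 1) ∧ τ'.reg 11 = q + i ∧ τ'.reg 12 = a ∧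
      τ'.reg 7 = n - (w + 1) ∧ ∀ b, τ'.mem b = if b = q + n + w then
        (if σ.mem (q + w) = a ∧ w ≠ i then 1 else 0) else τ.mem b := by
    refine ⟨_, rfl, ?_⟩
    by_cases hB : σ.mem (q + w) = a
    · by_cases hC : w = i
      · refine ⟨?_, ?_, ?_, ?_, ?_, ?_, ?_, ?_⟩
        all_goals simp [indicatorBody, ofList, eval, RamState.setReg, RamState.setMem,
          Function.update_apply, t9, t10, t11, t12, t7, r2, r15, m1, hB, hC]
        all_goals omega
      · have hC' : q + w - (q + i) + (q + i - (q + w)) ≠ 0 := by omega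
        refine ⟨?_, ?_, ?_, ?_, ?_, ?_, ?_, ?_⟩
        all_goals simp [indicatorBody, ofList, eval, RamState.setReg, RamState.setMem,
          Function.update_apply, t9, t10, t11, t12, t7, r2, r15, m1, hB, hC, hC',
          -Nat.add_eq_zero_iff, -add_eq_zero]
        all_goals omega
    · have hB' : σ.mem (q + w) - a + (a - σ.mem (q + w)) ≠ 0 := by omega
      refine ⟨?_, ?_, ?_, ?_, ?_, ?_, ?_, ?_⟩
      all_goals simp [indicatorBody, ofList, eval, RamState.setReg, RamState.setMem,
        Function.update_apply, t9, t10, t11, t12, t7, r2, r15, m1, hB, hB',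
        -Nat.add_eq_zero_iff, -add_eq_zero]
      all_goals omega
  obtain ⟨τ', hτ', u2, u15, u9, u10, u11, u12, u7, um⟩ := hval
  rw [hτ']
  refine ⟨⟨u2, u15, u9, u10, u11, u12, fun b hb => ?_, fun v hv => ?_⟩, u7⟩
  · rw [um, if_neg (by omega), hm b hb]
  · rw [um]
    by_cases hvw : v = w
    · rw [if_pos (by omega), hvw]
    · rw [if_neg (by omega), hm' v (by omega)]

theorem runs_push {n i k D v : ℕ} {σ : RamState} (h : PathRegisters n i k D σ) (hv : v < n)
    (h12 : σ.reg 12 = v * n) (h13 : σ.reg 13 = n ^ 2 + v) :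
    Runs push σ (30 * n + 30) fun τ => PathRegisters n i (k + 1) D τ ∧
      ∀ b, τ.mem b =
        if n ^ 2 + 2 * n + (k + 1) * n ≤ b ∧ b < n ^ 2 + 2 * n + (k + 1) * n + n then
          σ.mem (v * n + (b - (n ^ 2 + 2 * n + (k + 1) * n)))
        else if b = n ^ 2 + v then k + 1 else σ.mem b := by
  -- The copied row lies in the input area, below the row that is written, so the copy does not
  -- overwrite its source.
  have hvn : v * n + n ≤ n ^ 2 := by
    have := Nat.mul_le_mul_right n hv
    rw [Nat.succ_mul] at this
    rwa [pow_two]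
  obtain ⟨r0, r1, r2, r3, r4, r5, r6, r15⟩ := h
  have hT : ∀ x, x + (n * (copyBody.size + 1) + 1) ≤ x + 9 * n + 1 := by
    intro x
    simp only [copyBody, ofList, size]
    omega
  refine Runs.mono (Runs.seq_eval (T := n * (copyBody.size + 1) + 1) (by simp [LoopFree, ofList])
    (Runs.mono (runs_copy_loop (n := n) (i := i) (k := k + 1) (D := D)
      (d := n ^ 2 + 2 * n + (k + 1) * n) (s := v * n) ?_ ?_ ?_ ?_ ?_) le_rfl ?_)) ?_ fun _ => id
  · constructor
    all_goals simp [ofList, eval, RamState.setReg, RamState.setMem, Function.update_apply, r0, r1,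
      r2, r3, r4, r5, r6, r15, h12, h13]
    ring
  · simp [ofList, eval, RamState.setReg, RamState.setMem, Function.update_apply, r0, r15]
  · simp [ofList, eval, RamState.setReg, RamState.setMem, Function.update_apply, r0, r5, r15]
    ring
  · simp [ofList, eval, RamState.setReg, RamState.setMem, Function.update_apply, h12, r15]
  · omega
  · rintro τ ⟨hτ, hm⟩
    refine ⟨hτ, fun b => ?_⟩
    rw [hm]
    simp only [ofList, eval, RamState.setReg, RamState.setMem, Function.update_apply]
    simp [h13, r4, r2]
    split_ifs <;> first | rfl | omega
  · refine (hT _).trans ?_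
    simp only [ofList, size]
    omega

theorem runs_pop {n i k D a : ℕ} {σ : RamState} (h : PathRegisters n i k D σ) (hk : 1 ≤ k)
    (h19 : σ.reg 19 = a) :
    Runs pop σ (30 * n + 30) fun τ => PathRegisters n i (k - 1) (D + 1) τ ∧ ∀ b, τ.mem b =
      if n ^ 2 ≤ b ∧ b < n ^ 2 + n then (if σ.mem b = k then a else σ.mem b)
      else if n ^ 2 + 2 * n + (k - 1) * n ≤ b ∧ b < n ^ 2 + 2 * n + k * n then
        σ.mem b + σ.mem (b + n) else σ.mem b := by
  obtain ⟨j, rfl⟩ : ∃ j, k = j + 1 := ⟨k - 1, by omega⟩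
  obtain ⟨r0, r1, r2, r3, r4, r5, r6, r15⟩ := h
  have hr : n ^ 2 + 2 * n + (j + 1) * n - n = n ^ 2 + 2 * n + j * n := by
    rw [add_mul, one_mul]
    omega
  refine Runs.mono (Runs.seq_eval (T := n * (popBody.size + 1) + 1 + 4)
    (by simp [LoopFree, ofList]) (Runs.seq (Runs.mono
      (runs_pop_loop (n := n) (i := i) (k := j + 1) (D := D) (a := a) ?_ hk ?_ ?_ ?_ ?_ ?_)
      le_rfl ?_))) ?_ fun _ => id
  · constructor
    all_goals simp [ofList, eval, RamState.setReg, Function.update_apply, r0, r1,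
      r2, r3, r4, r5, r6, r15]
  · simp [ofList, eval, RamState.setReg, Function.update_apply, r0, r15]
  · simp [ofList, eval, RamState.setReg, Function.update_apply, r5, r15]
  · simp [ofList, eval, RamState.setReg, Function.update_apply, r5, r0, hr]
  · simp [ofList, eval, RamState.setReg, Function.update_apply, r3, r15]
  · simp [ofList, eval, RamState.setReg, Function.update_apply, h19]
  · rintro τ ⟨⟨t0, t1, t2, t3, t4, t5, t6, t15⟩, hm⟩
    refine Runs.of_eval (by simp [LoopFree, ofList]) ⟨?_, hm⟩
    constructor
    all_goals simp [ofList, eval, RamState.setReg, Function.update_apply, t0, t1,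
      t2, t3, t4, t5, t6, t15, hr]
  · simp only [popBody, ofList, size]
    omega

/-! ### The input encoding and the complete run. -/

theorem ramInput_mem_ne_zero_iff {n : ℕ} (A : Matrix (Fin n) (Fin n) ℝ) (i u v : Fin n) :
    (ramInput A i).mem (u * n + v) ≠ 0 ↔ A u v ≠ 0 := by
  have : (∃ u' v' : Fin n, (u : ℕ) * n + v = u' * n + v' ∧ A u' v' ≠ 0) ↔ A u v ≠ 0 := by
    refine ⟨?_, fun h => ⟨u, v, rfl, h⟩⟩
    rintro ⟨u', v', h, hA⟩
    have hv : v = v' := by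
      have := congrArg (· % n) h
      simp only [Nat.mul_add_mod_of_lt, Nat.mul_add_mod_of_lt, Nat.add_mod, Nat.mul_mod_left,
        zero_add, Nat.mod_mod, Nat.mod_eq_of_lt v.2, Nat.mod_eq_of_lt v'.2] at this
      exact Fin.ext this
    subst hv
    have hu : u = u' := Fin.ext (Nat.eq_of_mul_eq_mul_right (Fin.pos u) (Nat.add_right_cancel h))
    rwa [hu]
  simp only [ramInput]
  rw [← this]
  split_ifs with h <;> simp [h]

theorem ramInput_mem_of_le {n : ℕ} (A : Matrix (Fin n) (Fin n) ℝ) (i : Fin n) {b : ℕ}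
    (hb : n ^ 2 ≤ b) : (ramInput A i).mem b = 0 := by
  simp only [ramInput]
  rw [if_neg]
  rintro ⟨u, v, rfl, -⟩
  have := Nat.mul_le_mul_right n u.2
  rw [Nat.succ_mul, ← pow_two] at this
  omega

/-- The states of the machine between the steps of the path-based algorithm. -/
structure PathState {n : ℕ} (A : Matrix (Fin n) (Fin n) ℝ) (i : Fin n) (k D : ℕ) (σ : RamState) :
    Prop where
  regs : PathRegisters n i k D σ
  input : ∀ b < n ^ 2, σ.mem b = (ramInput A i).mem b
  inv : PathInvariant (fun u w => A u w ≠ 0) k D (fun v => σ.mem (n ^ 2 + v))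
    (fun p v => σ.mem (n ^ 2 + 2 * n + p * n + v))

/-- The factor two in the measure pays for the longer path: a push loses one unvisited node and
gains one block, while a merge or a finish loses one block and leaves the unvisited nodes alone. -/
theorem runs_pathStep {n k D : ℕ} {A : Matrix (Fin n) (Fin n) ℝ} {i : Fin n} {σ : RamState}
    (h : PathState A i k D σ) (hk : 1 ≤ k) :
    Runs pathStep σ (60 * n + 60) fun τ => ∃ k' D', PathState A i k' D' τ ∧
      2 * (Finset.univ.filter fun v : Fin n => τ.mem (n ^ 2 + v) = 0).card + k' <
        2 * (Finset.univ.filter fun v : Fin n => σ.mem (n ^ 2 + v) = 0).card + k := by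
  obtain ⟨⟨r0, r1, r2, r3, r4, r5, r6, r15⟩, hin, hinv⟩ := h
  have hrow : ∀ p < k, p * n + n ≤ k * n := fun p hp => by
    have := Nat.mul_le_mul_right n hp
    rwa [Nat.succ_mul] at this
  refine Runs.mono (Runs.seq_eval (T := n * (scanBody.size + 1) + 1 + (30 * n + 33))
    (by simp [LoopFree, ofList]) (Runs.seq (Runs.mono
      (runs_scan (n := n) (i := i) (k := k) (D := D) ?_ ?_ ?_ ?_ ?_ ?_) le_rfl ?_))) ?_ fun _ => id
  · constructor
    all_goals simp [ofList, eval, RamState.setReg, Function.update_apply, r0, r1,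
      r2, r3, r4, r5, r6, r15]
  · simp [ofList, eval, RamState.setReg, Function.update_apply, r0, r15]
  · simp [ofList, eval, RamState.setReg, Function.update_apply]
  · simp [ofList, eval, RamState.setReg, Function.update_apply, r5, r15]
  · simp [ofList, eval, RamState.setReg, Function.update_apply, r3, r15]
  · simp [ofList, eval, RamState.setReg, Function.update_apply]
  · rintro τ ⟨hτ, hm, hscan⟩
    have hm' : τ.mem = σ.mem := by
      rw [hm]
      simp [ofList, eval, RamState.setReg]
    have hm0 : ((ofList [.add 7 0 15, .const 8 0, .add 9 5 15, .add 10 3 15,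
        .const 11 0]).eval σ).mem = σ.mem := hm.symm.trans hm'
    rw [hm0] at hscan
    clear hm hm0
    -- the effect of `pop`
    have hpop : ∀ (a : ℕ) (ρ : RamState), PathRegisters n i k D ρ → ρ.mem = σ.mem →
        ρ.reg 19 = a → a ≠ 0 →
        ((∀ (L' : Fin n → ℕ) (R' : ℕ → Fin n → ℕ),
          (∀ w, L' w = if σ.mem (n ^ 2 + w) = k then a else σ.mem (n ^ 2 + w)) →
          (∀ p < k - 1, R' p = fun v : Fin n => σ.mem (n ^ 2 + 2 * n + p * n + v)) →
          (∀ w : Fin n, R' (k - 1) w = σ.mem (n ^ 2 + 2 * n + (k - 1) * n + w) +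
            σ.mem (n ^ 2 + 2 * n + k * n + w)) →
          PathInvariant (fun u w => A u w ≠ 0) (k - 1) (D + 1) L' R')) →
        Runs pop ρ (30 * n + 30) fun τ => ∃ k' D', PathState A i k' D' τ ∧
          2 * (Finset.univ.filter fun v : Fin n => τ.mem (n ^ 2 + v) = 0).card + k' <
            2 * (Finset.univ.filter fun v : Fin n => σ.mem (n ^ 2 + v) = 0).card + k := by
      intro a ρ hρ hρm ha ha0 hP
      refine (runs_pop hρ hk ha).mono le_rfl ?_
      rintro ω ⟨hω, hωm⟩
      rw [hρm] at hωm
      have hlab : ∀ w : Fin n, ω.mem (n ^ 2 + w) =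
          if σ.mem (n ^ 2 + w) = k then a else σ.mem (n ^ 2 + w) := fun w => by
        rw [hωm, if_pos (by omega)]
      refine ⟨k - 1, D + 1, ⟨hω, fun b hb => ?_, hP _ _ hlab ?_ ?_⟩, ?_⟩
      · rw [hωm, if_neg (by omega), if_neg (by omega), hin b hb]
      · intro p hp
        funext v
        have h1 := hrow p (by omega)
        have h2 : p * n + n ≤ (k - 1) * n := by
          have := Nat.mul_le_mul_right n hp
          rwa [Nat.succ_mul] at this
        show ω.mem _ = _
        rw [hωm, if_neg (by omega), if_neg (by omega)]
      · intro w
        have h1 : (k - 1) * n + n = k * n := by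
          rw [← Nat.succ_mul]
          congr 1
          omega
        rw [hωm, if_neg (by omega), if_pos (by omega)]
        congr 2
        omega
      · rw [PathInvariant.card_relabel hk ha0 hlab]
        omega
    refine Runs.mono (Runs.branch (T := 30 * n + 32) ?_ ?_) le_rfl fun _ => id
    · intro h8
      obtain ⟨v, hv, hvrow, hvk, h12, h13, h17⟩ := (hscan.resolve_left fun h => h8 h.1).2
      refine Runs.branch (T := 30 * n + 31) ?_ ?_
      · intro h17'
        rw [h17] at h17'
        obtain ⟨t0, t1, t2, t3, t4, t5, t6, t15⟩ := hτ
        have hlab := hinv.label ⟨v, hv⟩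
        have hlen := hinv.length
        simp only at hlab
        refine (Runs.seq_eval (T := 30 * n + 30) (by simp [LoopFree])
          (hpop (k - 1) _ ?_ ?_ ?_ ?_ ?_)).mono ?_ fun _ => id
        · constructor
          all_goals simp [eval, RamState.setReg, Function.update_apply, t0, t1,
            t2, t3, t4, t5, t6, t15]
        · simp [eval, RamState.setReg, hm']
        · simp [eval, RamState.setReg, t4, t2]
        · omega
        · intro L' R' h1 h2 h3
          exact hinv.merge (v := ⟨v, hv⟩) hvrow h17' hvk h1 h2 h3
        · simp only [size]
          omega
      · intro h17'
        rw [h17] at h17'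
        refine (runs_push hτ hv h12 h13).mono (by omega) ?_
        rintro ω ⟨hω, hωm⟩
        rw [hm'] at hωm
        have hk1 : (k + 1) * n = k * n + n := by ring
        have hL' : ∀ w : Fin n, ω.mem (n ^ 2 + w) =
            if w = ⟨v, hv⟩ then k + 1 else σ.mem (n ^ 2 + w) := by
          intro w
          rw [hωm, if_neg (by omega)]
          refine if_congr ?_ rfl rfl
          simp only [Fin.ext_iff]
          omega
        have hR' : ∀ p ≤ k, (fun w : Fin n => ω.mem (n ^ 2 + 2 * n + p * n + w)) =
            fun w : Fin n => σ.mem (n ^ 2 + 2 * n + p * n + w) := by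
          intro p hp
          funext w
          have h1 : p * n ≤ k * n := Nat.mul_le_mul_right n hp
          rw [hωm, if_neg (by omega), if_neg (by omega)]
        have hRk : ∀ w : Fin n, ω.mem (n ^ 2 + 2 * n + (k + 1) * n + w) ≠ 0 ↔ A ⟨v, hv⟩ w ≠ 0 := by
          intro w
          have hvn : v * n + n ≤ n ^ 2 := by
            have := Nat.mul_le_mul_right n hv
            rw [Nat.succ_mul] at this
            rwa [pow_two]
          rw [hωm, if_pos (by omega), Nat.add_sub_cancel_left, hin _ (by omega)]
          exact ramInput_mem_ne_zero_iff A i ⟨v, hv⟩ w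
        obtain ⟨hP, hcard⟩ := hinv.push (v := ⟨v, hv⟩) (L' := fun v => ω.mem (n ^ 2 + v))
          (R' := fun p v => ω.mem (n ^ 2 + 2 * n + p * n + v)) hk hvrow h17' hL' hR' hRk
        refine ⟨k + 1, D, ⟨hω, fun b hb => ?_, hP⟩, by omega⟩
        rw [hωm, if_neg (by omega), if_neg (by omega), hin b hb]
    · intro h8
      have hno := (hscan.resolve_right fun h => h.1 h8).2
      obtain ⟨t0, t1, t2, t3, t4, t5, t6, t15⟩ := hτ
      have hbd := hinv.bound
      refine (Runs.seq_eval (T := 30 * n + 30) (by simp [LoopFree])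
        (hpop D _ ?_ ?_ ?_ ?_ ?_)).mono ?_ fun _ => id
      · constructor
        all_goals simp [eval, RamState.setReg, Function.update_apply, t0, t1,
          t2, t3, t4, t5, t6, t15]
      · simp [eval, RamState.setReg, hm']
      · simp [eval, RamState.setReg, t6, t15]
      · omega
      · intro L' R' h1 h2 h3
        exact hinv.finish hk (fun v hv => hno v v.2 hv) h1 h2 h3
      · simp only [size]
        omega
  · simp only [ofList, scanBody, size]
    omega

/-- The measure starts at `2 * n + 1`, with all nodes unvisited and only the virtual root on the
path. The other loops take linear time, and `1 ≤ n` absorbs lower order terms into the generous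
constant. -/
theorem runs_equivalent {n : ℕ} (hn : 1 ≤ n) (A : Matrix (Fin n) (Fin n) ℝ) (i : Fin n) :
    Runs equivalent (ramInput A i) (1000 * n ^ 2) fun τ =>
      (∀ u v : Fin n, τ.mem (n ^ 2 + u) = τ.mem (n ^ 2 + v) ↔
        Relation.ReflTransGen (fun u w => A u w ≠ 0) u v ∧
          Relation.ReflTransGen (fun u w => A u w ≠ 0) v u) ∧
      ∀ v : Fin n, τ.mem (n ^ 2 + n + v) =
        if τ.mem (n ^ 2 + v) = τ.mem (n ^ 2 + i) ∧ v ≠ i then 1 else 0 := by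
  refine Runs.mono (Runs.seq_eval (T := n * (squareBody.size + 1) + 1 + (9 + (n * (fillBody.size + 1)
    + 1 + ((2 * n + 1) * (60 * n + 60 + 1) + 1 + (6 + (n * (indicatorBody.size + 1) + 1))))))
    (by simp [LoopFree, ofList]) (Runs.seq (Runs.mono (runs_square_loop (n := n) ?_ ?_ ?_ ?_)
      le_rfl ?_))) ?_ fun _ => id
  · simp [ofList, eval, RamState.setReg, Function.update_apply, ramInput]
  · simp [ofList, eval, RamState.setReg, Function.update_apply, ramInput]
  · simp [ofList, eval, RamState.setReg, Function.update_apply, ramInput]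
  · simp [ofList, eval, RamState.setReg, Function.update_apply, ramInput]
  · rintro σ ⟨s0, s1, s2, s3, s15, hm⟩
    replace s1 : σ.reg 1 = i := by
      rw [s1]
      simp [ofList, eval, RamState.setReg, Function.update_apply, ramInput]
    replace s15 : σ.reg 15 = 0 := by
      rw [s15]
      simp [ofList, eval, RamState.setReg, Function.update_apply, ramInput]
    replace hm : σ.mem = (ramInput A i).mem := hm
    refine Runs.mono (Runs.seq_eval (T := n * (fillBody.size + 1) + 1 +
      ((2 * n + 1) * (60 * n + 60 + 1) + 1 + (6 + (n * (indicatorBody.size + 1) + 1))))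
      (by simp [LoopFree, ofList]) (Runs.seq (Runs.mono (runs_fill_loop (n := n) (i := i) (k := 1) (D := n + 2) (d := n ^ 2 + 2 * n + 1 * n)
        ?_ ?_ ?_) le_rfl ?_))) ?_ fun _ => id
    · constructor
      all_goals simp [ofList, eval, RamState.setReg, Function.update_apply, s0, s1, s2, s3, s15]
      omega
    · simp [ofList, eval, RamState.setReg, Function.update_apply, s0, s15]
    · simp [ofList, eval, RamState.setReg, Function.update_apply, s0, s3, s15]
      omega
    · rintro τ ⟨hτ, hτm⟩
      replace hτm : ∀ b, τ.mem b = if n ^ 2 + 2 * n + 1 * n ≤ b ∧ b < n ^ 2 + 2 * n + 1 * n + n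
          then 1 else (ramInput A i).mem b := by
        rw [← hm]
        exact hτm
      have hlab : ∀ v : Fin n, τ.mem (n ^ 2 + v) = 0 := fun v => by
        rw [hτm, if_neg (by omega), ramInput_mem_of_le A i (by omega)]
      have hτs : PathState A i 1 (n + 2) τ := by
        refine ⟨hτ, fun b hb => ?_, PathInvariant.init le_rfl hlab fun v => ?_⟩
        · rw [hτm, if_neg (by omega)]
        · rw [hτm, if_pos (by omega)]
          exact one_ne_zero
      refine Runs.seq (Runs.mono (Runs.loop (T := 60 * n + 60)
        (fun m σ => ∃ k D, PathState A i k D σ ∧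
          2 * (Finset.univ.filter fun v : Fin n => σ.mem (n ^ 2 + v) = 0).card + k = m)
        ?_ (2 * n + 1) τ ⟨1, n + 2, hτs, by simp [hlab]⟩) le_rfl ?_)
      · rintro m ρ ⟨k, D, hρ, rfl⟩ h4
        rw [hρ.regs.r4] at h4
        refine (runs_pathStep hρ (by omega)).mono le_rfl ?_
        rintro ω ⟨k', D', hω, hlt⟩
        exact ⟨_, hlt, k', D', hω, rfl⟩
      · rintro ρ ⟨h4, m, k, D, ⟨⟨t0, t1, t2, t3, t4, t5, t6, t15⟩, -, hinv⟩, -⟩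
        obtain rfl : k = 0 := by omega
        refine Runs.seq_eval (by simp [LoopFree, ofList]) (Runs.mono (runs_indicator_loop
          (n := n) (q := n ^ 2) (i := i) (a := ρ.mem (n ^ 2 + i)) ?_ ?_ ?_ ?_ ?_ ?_ ?_) le_rfl ?_)
        · simp [ofList, eval, RamState.setReg, Function.update_apply, t2]
        · simp [ofList, eval, RamState.setReg, Function.update_apply, t15]
        · simp [ofList, eval, RamState.setReg, Function.update_apply, t0, t15]
        · simp [ofList, eval, RamState.setReg, Function.update_apply, t3, t0]
        · simp [ofList, eval, RamState.setReg, Function.update_apply, t3, t15]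
        · simp [ofList, eval, RamState.setReg, Function.update_apply, t3, t1]
        · simp [ofList, eval, RamState.setReg, Function.update_apply, t3, t1]
        · rintro ω ⟨hω, hωi⟩
          replace hω : ∀ v : Fin n, ω.mem (n ^ 2 + v) = ρ.mem (n ^ 2 + v) := fun v =>
            hω _ (by omega)
          refine ⟨fun u v => ?_, fun v => ?_⟩
          · rw [hω, hω]
            exact hinv.label_eq_iff u v
          · rw [hω, hω, hωi v v.2]
            simp only [ne_eq, Fin.ext_iff]
            rfl
    · simp only [ofList, size]
      omega
  · simp only [ofList, size, squareBody, fillBody, indicatorBody]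
    nlinarith

/-- The states equivalent to a state are found in time `O(n²)`. -/
theorem exists_findsEquivalentStates : ∃ (P : RamProgram) (c : ℕ), FindsEquivalentStates P c := by
  refine ⟨equivalent, 1000, fun n A i => ?_⟩
  obtain ⟨τ, t, he, ht, hlab, heq⟩ := runs_equivalent (Fin.pos i) A i
  have hscc : ∀ u v : Fin n, τ.mem (n ^ 2 + u) = τ.mem (n ^ 2 + v) ↔
      ∃ C, (systemDigraph A).IsSCC C ∧ u ∈ C ∧ v ∈ C := by
    intro u v
    rw [hlab, Digraph.exists_isSCC_iff]
    -- The rows of `A` list the links of the reversed digraph, which has the same components.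
    refine and_comm.trans (and_congr ?_ ?_)
    all_goals exact Relation.reflTransGen_swap
  refine ⟨τ, t, he, ht, hscc, fun v => ?_⟩
  rw [heq]
  have hv : v ∈ (systemDigraph A).equivalentStates i ↔
      τ.mem (n ^ 2 + v) = τ.mem (n ^ 2 + i) ∧ v ≠ i := by
    rw [eq_comm, hscc]
    exact and_comm
  simp only [hv]

/-! ### Assembly of the main theorem. -/

theorem mainTheorem2 :
    -- Structural observability and recovery after the failure of the type-β sensor `k`.
    (∀ (n m : ℕ) (A : Matrix (Fin n) (Fin n) ℝ) (s : Fin m → Fin n) (M : Finset (Fin n × Fin n))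
        (Gβ : Digraph (Fin m)) (k : Fin m) (C : Set (Fin n)),
      -- `M` is a maximum matching, and all its unmatched states are measured
      (systemDigraph A).IsMaximumLinkMatching M →
      (∀ v ∈ unmatched M, ∃ l, s l = v) →
      -- before the failure the system is observable
      StructurallyObservable A s →
      -- the prediction-fusion network (every sensor also uses its own prediction)
      Gβ.StronglyConnected → (∀ l, Gβ.Adj l l) →
      -- the failed sensor is of type β (and not of type α)
      (systemDigraph A).IsParentSCC C → s k ∈ C → s k ∉ unmatched M →
      -- once the unmatched states are measured, one state per parent SCC is all that is required
      (∀ (p : ℕ) (r : Fin p → Fin n), (∀ v ∈ unmatched M, ∃ l, r l = v) →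
        (StructurallyObservable A r ↔
          ∀ D, (systemDigraph A).IsParentSCC D → ∃ l, r l ∈ D)) ∧
      -- any other state of the same parent SCC restores observability
      (∀ j ∈ C, j ≠ s k →
        j ∈ (systemDigraph A).equivalentStates (s k) ∧
        StructurallyObservable A (Function.update s k j) ∧
        DistributedObservable A (Function.update s k j) Gβ
          (hubNeighborhood (Finset.univ.filter fun l => s l ∈ unmatched M))) ∧
      -- if no other sensor measures a state of `C`, then the failure destroys observability, and
      -- no state outside of `C` restores it
      ((∀ l, l ≠ k → s l ∉ C) →
        ¬ StructurallyObservable A (fun l : {l : Fin m // l ≠ k} => s l) ∧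
        ∀ j ∉ C,
          ¬ StructurallyObservable A (Function.update s k j) ∧
          ¬ DistributedObservable A (Function.update s k j) Gβ
            (hubNeighborhood (Finset.univ.filter fun l => s l ∈ unmatched M))) ∧
      -- a parent SCC with a single node offers no equivalent state
      (C = {s k} → (systemDigraph A).equivalentStates (s k) = ∅)) ∧
    -- The equivalent states are found by an SCC decomposition in `O(n²)` steps.
    (∃ (P : RamProgram) (c : ℕ), FindsEquivalentStates P c) := by
  refine ⟨?_, exists_findsEquivalentStates⟩
  intro n m A s M Gβ k C hM hs hobs hG hloop hC hk hkM
  refine ⟨fun p r hr => structurallyObservable_iff hM.1 r hr, fun j hj hjk => ?_, fun h =>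
    sensor_failure _ hC h, fun h => ?_⟩
  · exact ⟨(hC.1.mem_equivalentStates_iff hk).2 ⟨hjk, hj⟩,
      sensor_recovery hM.1 hs hobs hG hloop hC hk hkM hj⟩
  · ext j
    rw [hC.1.mem_equivalentStates_iff hk, h]
    simp
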